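/- **K-user polar splitting.** Let $K\ge 1$, and let $p=p(q)\big(\prod_{j=1}^K p(x_j\mid q)\big)P(y\mid x_1,\dots,x_K)$, where $P$ is a discrete memoryless $K$-user multiple-access channel with binary inputs $X_1,\dots,X_K\in\{0,1\}$ and a finite output alphabet, and $Q\sim p(q)$ is a time-sharing random variable with a finite alphabet (the case of constant $Q$ and uniform inputs is included). All mutual informations are in bits. Let $\mathscr R_{[1::K]}(p)$ be the set of tuples $(R_1,\dots,R_K)$ of non-negative reals such that $$\sum_{j\in\mathcal J}R_j\le I(X_{\mathcal J};Y,X_{[1::K]\setminus\mathcal J}\mid Q)\qquad\text{for all }\mathcal J\subseteq[1::K];$$ its dominant face is the set of its elements with $\sum_{j=1}^K R_j=I(X_1,\dots,X_K;Y\mid Q)$. For $N=2^n$ let $(Q_t,X_{1t},\dots,X_{Kt},Y_t)$, $t=1,\dots,N$, be independent copies of $(Q,X_1,\dots,X_K,Y)\sim p$, and let $U_j^N=X_j^NG_N$ over $\mathbb F_2$, where $G_N=\left[\begin{smallmatrix}1&0\\1&1\end{smallmatrix}\right]^{\otimes n}B_N$ and $B_N$ is the bit-reversal permutation matrix. A permutation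 $S^{KN}=(S_1,\dots,S_{KN})$ of the $KN$ symbols $(U_1^N,\dots,U_K^N)$ is *monotone* if for every $j$ the elements of $U_j^N$ appear in it in increasing order. For such a permutation put $$\mathcal S_j=\{i: S_i=U_{jk}\text{ for some }k\},\qquad R_j=\frac1N\sum_{i\in\mathcal S_j}I(S_i;Y^N\mid S^{i-1},Q^N),$$ $$\mathcal G^{(j)}=\{i\in\mathcal S_j: I(S_i;Y^N\mid S^{i-1},Q^N)>1-2^{-N^\beta}\}$$ (for constant $Q$ the conditioning on $Q^N$ disappears). Then for every $\epsilon>0$, every $\beta<1/2$ and every rate tuple $(I_1,\dots,I_K)$ on the dominant face of $\mathscr R_{[1::K]}(p)$ there exist an $N=2^n$ and a monotone permutation $S^{KN}$ such that for all $j\in[1::K]$: (i) $|R_j-I_j|\le\epsilon$; (ii) $\dfrac{|\mathcal G^{(j)}|}{N}>R_j-\epsilon$. -/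

import Mathlib

namespace PolarMAC

open Finset

noncomputable section

/-! ### Information measures (in bits) on a finite probability space

`μ : Ω → ℝ` is the probability mass function of a finite sample space `Ω`, and random variables are
functions on `Ω` with values in a finite type. -/

section Information

variable {Ω α β γ : Type*} [Fintype Ω] [Fintype α] [Fintype β] [Fintype γ]

open Classical in
/-- The probability that the random variable `A` takes the value `a`. -/
def prob (μ : Ω → ℝ) (A : Ω → α) (a : α) : ℝ :=
  ∑ ω with A ω = a, μ ω

/-- Shannon entropy `H(A) = -∑ₐ P(A = a) log₂ P(A = a)`. -/
def entropy (μ : Ω → ℝ) (A : Ω → α) : ℝ :=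
  ∑ a, -(prob μ A a * Real.logb 2 (prob μ A a))

/-- Conditional entropy `H(A | C) = H(A, C) - H(C)`. -/
def condEntropy (μ : Ω → ℝ) (A : Ω → α) (C : Ω → γ) : ℝ :=
  entropy μ (fun ω => (A ω, C ω)) - entropy μ C

/-- Conditional mutual information `I(A; B | C) = H(A | C) - H(A | B, C)`. -/
def condMutualInfo (μ : Ω → ℝ) (A : Ω → α) (B : Ω → β) (C : Ω → γ) : ℝ :=
  condEntropy μ A C - condEntropy μ A (fun ω => (B ω, C ω))

end Information

/-! ### The polar transform -/

/-- The kernel `F = [1 0; 1 1]` over the two-element field. -/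
def kernel : Matrix (Fin 2) (Fin 2) (ZMod 2) := !![1, 0; 1, 1]

/-- The binary digits of an index `a < 2 ^ n`, least significant digit first. -/
def bits (n : ℕ) (a : Fin (2 ^ n)) : Fin n → Fin 2 :=
  finFunctionFinEquiv.symm a

/-- The `n`-fold Kronecker power of `F`, with rows and columns indexed by `0, …, 2 ^ n - 1`: its
entries are the products of the entries of `F` at the binary digits of the two indices. -/
def kernelPow (n : ℕ) : Matrix (Fin (2 ^ n)) (Fin (2 ^ n)) (ZMod 2) :=
  Matrix.of fun a b => ∏ t, kernel (bits n a t) (bits n b t)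

/-- The bit-reversal permutation of `0, …, 2 ^ n - 1`. -/
def bitReversal (n : ℕ) : Equiv.Perm (Fin (2 ^ n)) :=
  (finFunctionFinEquiv.symm.trans (Equiv.arrowCongr Fin.revPerm (Equiv.refl (Fin 2)))).trans
    finFunctionFinEquiv

/-- The polar transform matrix `G_N = F^{⊗ n} B_N` with `N = 2 ^ n`. -/
def polarMatrix (n : ℕ) : Matrix (Fin (2 ^ n)) (Fin (2 ^ n)) (ZMod 2) :=
  kernelPow n * (bitReversal n).permMatrix (ZMod 2)

/-! ### Multiple-access channels -/

/-- A distribution `p = p(q) (∏ⱼ p(xⱼ | q)) P(y | x₁, …, x_K)`: a time-sharing variable with finite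
alphabet `𝒬`, binary inputs of the `K` users that are conditionally independent given it, and a
discrete channel with finite output alphabet `𝒴`. -/
structure MACLaw (K : ℕ) (𝒬 𝒴 : Type*) where
  /-- the law `p(q)` of the time-sharing variable -/
  timeSharing : PMF 𝒬
  /-- the conditional laws `p(xⱼ | q)` of the inputs -/
  input : Fin K → 𝒬 → PMF (ZMod 2)
  /-- the channel `P(y | x₁, …, x_K)` -/
  channel : (Fin K → ZMod 2) → PMF 𝒴

/-- The sample space of a single channel use: points are triples `(q, (x₁, …, x_K), y)`. -/
abbrev Letter (K : ℕ) (𝒬 𝒴 : Type*) : Type _ := 𝒬 × (Fin K → ZMod 2) × 𝒴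

section MAC

variable {K : ℕ} {𝒬 𝒴 : Type*}

/-- The probability mass function `p(q) (∏ⱼ p(xⱼ | q)) P(y | x₁, …, x_K)`. -/
def MACLaw.letterLaw (p : MACLaw K 𝒬 𝒴) (ω : Letter K 𝒬 𝒴) : ℝ :=
  (p.timeSharing ω.1).toReal * (∏ j, (p.input j ω.1 (ω.2.1 j)).toReal) *
    (p.channel ω.2.1 ω.2.2).toReal

/-- The law of `N` independent channel uses. -/
def MACLaw.blockLaw (p : MACLaw K 𝒬 𝒴) (N : ℕ) (ω : Fin N → Letter K 𝒬 𝒴) : ℝ :=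
  ∏ t, p.letterLaw (ω t)

/-! ### Monotone chain rules -/

/-- A monotone permutation of `(U₁^N, …, U_K^N)`: position `i` of the new sequence holds `U_{jk}`
with `(j, k) = toEquiv i`, and for each `j` the elements of `U_j^N` appear in increasing order. -/
structure MonotonePermutation (K N : ℕ) where
  /-- the user and the index of the symbol in a given position -/
  toEquiv : Fin (K * N) ≃ Fin K × Fin N
  /-- the symbols of each user appear in increasing order -/
  monotone : ∀ (j : Fin K) (k l : Fin N), k < l → toEquiv.symm (j, k) < toEquiv.symm (j, l)

/-- The positions `𝒮_j` that hold symbols of user `j`. -/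
def MonotonePermutation.positions {N : ℕ} (σ : MonotonePermutation K N) (j : Fin K) :
    Finset (Fin (K * N)) :=
  {i | (σ.toEquiv i).1 = j}

variable {n : ℕ}

/-- The polar-transformed inputs `U_j^N = X_j^N G_N`, `N = 2 ^ n`. -/
def transformed (ω : Fin (2 ^ n) → Letter K 𝒬 𝒴) (j : Fin K) : Fin (2 ^ n) → ZMod 2 :=
  Matrix.vecMul (fun t => (ω t).2.1 j) (polarMatrix n)

/-- The permuted sequence `S^{KN}` of the polar-transformed inputs. -/
def permuted (σ : MonotonePermutation K (2 ^ n)) (ω : Fin (2 ^ n) → Letter K 𝒬 𝒴)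
    (i : Fin (K * 2 ^ n)) : ZMod 2 :=
  transformed ω (σ.toEquiv i).1 (σ.toEquiv i).2

/-! ### Rate region, rates of a monotone permutation, good indices -/

variable [Fintype 𝒬] [Fintype 𝒴]

/-- `I(X_J; Y, X_{Jᶜ} | Q)` for a set `J` of users. -/
def MACLaw.rateBound (p : MACLaw K 𝒬 𝒴) (J : Finset (Fin K)) : ℝ :=
  condMutualInfo p.letterLaw
    (fun ω (j : {j // j ∈ J}) => ω.2.1 j)
    (fun ω => (ω.2.2, fun j : {j // j ∈ Jᶜ} => ω.2.1 j))
    (fun ω => ω.1)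

/-- The region of the rate tuples with `R(J) ≤ I(X_J; Y, X_{Jᶜ} | Q)` for all sets `J` of users. -/
def MACLaw.region (p : MACLaw K 𝒬 𝒴) : Set (Fin K → ℝ) :=
  {R | (∀ j, 0 ≤ R j) ∧ ∀ J : Finset (Fin K), ∑ j ∈ J, R j ≤ p.rateBound J}

/-- The dominant face of the region: the rate tuples in it whose sum rate is
`I(X₁, …, X_K; Y | Q)`. -/
def MACLaw.dominantFace (p : MACLaw K 𝒬 𝒴) : Set (Fin K → ℝ) :=
  {R | R ∈ p.region ∧
    ∑ j, R j = condMutualInfo p.letterLaw (fun ω => ω.2.1) (fun ω => ω.2.2) (fun ω => ω.1)}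

/-- `I(S_i; Y^N | S^{i-1}, Q^N)` with `N = 2 ^ n`. -/
def MACLaw.indexInfo (p : MACLaw K 𝒬 𝒴) (σ : MonotonePermutation K (2 ^ n))
    (i : Fin (K * 2 ^ n)) : ℝ :=
  condMutualInfo (p.blockLaw (2 ^ n))
    (fun ω => permuted σ ω i)
    (fun ω t => (ω t).2.2)
    (fun ω => ((fun l : {l // l < i} => permuted σ ω l), fun t => (ω t).1))

/-- The associated rate `R_j = (1 / N) ∑_{i ∈ 𝒮_j} I(S_i; Y^N | S^{i-1}, Q^N)`. -/
def MACLaw.rate (p : MACLaw K 𝒬 𝒴) (σ : MonotonePermutation K (2 ^ n)) (j : Fin K) : ℝ :=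
  1 / (2 ^ n : ℝ) * ∑ i ∈ σ.positions j, p.indexInfo σ i

open Classical in
/-- The good indices `{i ∈ 𝒮_j : I(S_i; Y^N | S^{i-1}, Q^N) > 1 - 2^{-N^β}}` of user `j`. -/
def MACLaw.goodIndices (p : MACLaw K 𝒬 𝒴) (σ : MonotonePermutation K (2 ^ n)) (β : ℝ)
    (j : Fin K) : Finset (Fin (K * 2 ^ n)) :=
  {i ∈ σ.positions j | p.indexInfo σ i > 1 - (2 : ℝ) ^ (-(((2 : ℝ) ^ n) ^ β))}

end MAC

end

end PolarMAC

/-!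
Fix `W`, either the time-sharing variable `Q` or the pair `(Q, Y)`, and let `E_W(a)` be the entropy
of `W^N` together with the symbols `U_{jk}`, `k < a j`, at a lattice point `a ∈ {0, …, N} ^ K`. A
monotone permutation is a lattice path from `0` to `(N, …, N)`, and its indexed informations are the
increments of `F = E_Q - E_{QY}` along the path.

*Rates.* Doubling the block length doubles `F` at the doubled lattice points
(`MACLaw.prefixEntropy_double`), so at the corners of the cube `F / N` has the values
`I(X_J; Y | Q)`, up to a constant. The inputs are conditionally independent given `Q`, so on the
dominant face `R(J) ≥ I(X_J; Y | Q)`, with equality for the set of all users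
(`MACLaw.le_sum_of_mem_dominantFace`). Since `F` changes by at most `1` per step,
`exists_walk` gives a path whose increments sum, for each user, to `N R_j` up to a constant that
depends only on `K`: advance one user until the inequality for some set `J` of other users becomes
tight, and split the problem into one for `J` followed by one for the remaining users.

*Polarization.* Replacing each step of a path by `2 ^ l` steps of the same user keeps the rates and
applies `l` steps of the polar transform to each symbol of the original path, viewed as a binary
source with side information (the preceding symbols and `W^N`). For such a source let `z` be the
Bhattacharyya parameter `2 ∑ √(P(0, c) P(1, c))` and `d` the variational distance
`∑ |P(0, c) - P(1, c)|`. One step gives `z⁺ = z²`, `z⁻ ≤ 2 z - z²`, and dually `d⁻ = d²`,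
`d⁺ ≤ 2 d - d²`, while `z² + d² ≤ 1` and the conditional entropy `h` is preserved on average. Hence
`√(z d)` is contracted on average by a factor below `1`, so `z` or `d` becomes exponentially small,
and the fractions are forced by `h ≤ 3 z` and `1 - h ≤ 3 d`. A small parameter is then squared at
about half of the remaining steps, which gives every exponent `β < 1 / 2`
(`IsPolarizing.mean_three_stages`). Applied to `d` for `W = Q` and to `z` for `W = (Q, Y)`, this
gives the good indices.
-/

namespace PolarMAC

open Finset

noncomputable section

/-! ### Abstract polarization processes -/

/-- The mean of `f` over the two children `m x` and `p x` of a node `x` of a binary tree. The mean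
over the descendants `n` generations below `x` is `(branchMean m p)^[n] f x`. -/
def branchMean {X : Type*} (m p : X → X) (f : X → ℝ) (x : X) : ℝ :=
  (f (m x) + f (p x)) / 2

section BranchMean

variable {X : Type*} (m p : X → X)

theorem branchMean_comm : branchMean m p = branchMean p m := by
  funext f x
  simp only [branchMean, add_comm]

theorem branchMean_iterate_succ (n : ℕ) (f : X → ℝ) (x : X) :
    (branchMean m p)^[n + 1] f x =
      ((branchMean m p)^[n] f (m x) + (branchMean m p)^[n] f (p x)) / 2 := by
  rw [Function.iterate_succ_apply']
  rfl

theorem branchMean_iterate_mono {f g : X → ℝ} (h : ∀ x, f x ≤ g x) (n : ℕ) (x : X) :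
    (branchMean m p)^[n] f x ≤ (branchMean m p)^[n] g x := by
  induction n generalizing x with
  | zero => exact h x
  | succ n ih =>
    rw [branchMean_iterate_succ, branchMean_iterate_succ]
    linarith [ih (m x), ih (p x)]

theorem branchMean_iterate_add (f g : X → ℝ) (n : ℕ) (x : X) :
    (branchMean m p)^[n] (fun y => f y + g y) x =
      (branchMean m p)^[n] f x + (branchMean m p)^[n] g x := by
  induction n generalizing x with
  | zero => rfl
  | succ n ih =>
    simp only [branchMean_iterate_succ, ih]
    ring

theorem branchMean_iterate_mul_const (f : X → ℝ) (c : ℝ) (n : ℕ) (x : X) :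
    (branchMean m p)^[n] (fun y => f y * c) x = (branchMean m p)^[n] f x * c := by
  induction n generalizing x with
  | zero => rfl
  | succ n ih =>
    simp only [branchMean_iterate_succ, ih]
    ring

theorem branchMean_iterate_const (c : ℝ) (n : ℕ) (x : X) :
    (branchMean m p)^[n] (fun _ => c) x = c := by
  induction n generalizing x with
  | zero => rfl
  | succ n ih =>
    simp only [branchMean_iterate_succ, ih]
    ring

theorem branchMean_iterate_of_harmonic {h : X → ℝ} (hh : ∀ x, h (m x) + h (p x) = 2 * h x)
    (n : ℕ) (x : X) : (branchMean m p)^[n] h x = h x := by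
  induction n generalizing x with
  | zero => rfl
  | succ n ih =>
    simp only [branchMean_iterate_succ, ih, hh]
    ring

end BranchMean

/-- The properties of the polar transform of a binary source that force polarization. At a node `x`
of the binary tree, `z x` is the Bhattacharyya parameter, `d x` the variational distance between the
two values of the source and `h x` the conditional entropy; `m x` and `p x` are the two sources
obtained by one step of the transform. -/
structure IsPolarizing {X : Type*} (m p : X → X) (z d h : X → ℝ) : Prop where
  z_nonneg : ∀ x, 0 ≤ z x
  d_nonneg : ∀ x, 0 ≤ d x
  h_nonneg : ∀ x, 0 ≤ h x
  h_le_one : ∀ x, h x ≤ 1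
  z_minus : ∀ x, z (m x) ≤ 2 * z x - z x ^ 2
  z_plus : ∀ x, z (p x) ≤ z x ^ 2
  d_minus : ∀ x, d (m x) ≤ d x ^ 2
  d_plus : ∀ x, d (p x) ≤ 2 * d x - d x ^ 2
  sq_add_sq : ∀ x, z x ^ 2 + d x ^ 2 ≤ 1
  harmonic : ∀ x, h (m x) + h (p x) = 2 * h x
  h_le : ∀ x, h x ≤ 3 * z x
  one_sub_h_le : ∀ x, 1 - h x ≤ 3 * d x

/-- The duality that exchanges the two children, `z` with `d`, and `h` with `1 - h`. -/
theorem IsPolarizing.swap {X : Type*} {m p : X → X} {z d h : X → ℝ}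
    (H : IsPolarizing m p z d h) : IsPolarizing p m d z (fun x => 1 - h x) where
  z_nonneg := H.d_nonneg
  d_nonneg := H.z_nonneg
  h_nonneg x := by linarith [H.h_le_one x]
  h_le_one x := by linarith [H.h_nonneg x]
  z_minus := H.d_plus
  z_plus := H.d_minus
  d_minus := H.z_plus
  d_plus := H.z_minus
  sq_add_sq x := by linarith [H.sq_add_sq x]
  harmonic x := by linarith [H.harmonic x]
  h_le := H.one_sub_h_le
  one_sub_h_le x := by linarith [H.h_le x]

/-- The pair of factors by which one step of the transform changes `√(z d)` has mean bounded away
from `1` on the quarter disc. -/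
theorem sqrt_add_sqrt_le {z d : ℝ} (hz : 0 ≤ z) (hd : 0 ≤ d) (h : z ^ 2 + d ^ 2 ≤ 1) :
    (√(z * (2 - d)) + √(d * (2 - z))) / 2 ≤ 999 / 1000 := by
  have hz1 : z ≤ 1 := by nlinarith
  have hd1 : d ≤ 1 := by nlinarith
  have hP : 0 ≤ z * (2 - d) := mul_nonneg hz (by linarith)
  have hQ : 0 ≤ d * (2 - z) := mul_nonneg hd (by linarith)
  have hsP := Real.sq_sqrt hP
  have hsQ := Real.sq_sqrt hQ
  have hnP := Real.sqrt_nonneg (z * (2 - d))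
  have hnQ := Real.sqrt_nonneg (d * (2 - z))
  set P := √(z * (2 - d))
  set Q := √(d * (2 - z))
  by_cases hz' : z ≤ 95 / 100
  · by_cases hd' : d ≤ 95 / 100
    · have h1 : P ^ 2 + Q ^ 2 ≤ 2 * (9975 / 10000) := by nlinarith
      nlinarith [sq_nonneg (P - Q)]
    · have hz2 : z ≤ 313 / 1000 := by nlinarith
      have h1 : P ≤ 575 / 1000 := by
        apply le_of_sq_le_sq _ (by norm_num)
        nlinarith
      have h2 : Q ≤ 1415 / 1000 := by
        apply le_of_sq_le_sq _ (by norm_num)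
        nlinarith
      linarith
  · have hd2 : d ≤ 313 / 1000 := by nlinarith
    have h1 : Q ≤ 575 / 1000 := by
      apply le_of_sq_le_sq _ (by norm_num)
      nlinarith
    have h2 : P ≤ 1415 / 1000 := by
      apply le_of_sq_le_sq _ (by norm_num)
      nlinarith
    linarith

namespace IsPolarizing

variable {X : Type*} {m p : X → X} {z d h : X → ℝ}

theorem z_le_one (H : IsPolarizing m p z d h) (x : X) : z x ≤ 1 := by
  nlinarith [H.sq_add_sq x, H.z_nonneg x, sq_nonneg (d x)]

theorem d_le_one (H : IsPolarizing m p z d h) (x : X) : d x ≤ 1 := H.swap.z_le_one x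

/-- The potential `√(z d)` is contracted on average. -/
theorem sqrt_step (H : IsPolarizing m p z d h) (x : X) :
    branchMean m p (fun y => √(z y * d y)) x ≤ √(z x * d x) * (999 / 1000) := by
  have hz := H.z_nonneg x
  have hd := H.d_nonneg x
  have h1 : √(z (p x) * d (p x)) ≤ √(z x * d x) * √(z x * (2 - d x)) := by
    rw [← Real.sqrt_mul (mul_nonneg hz hd)]
    apply Real.sqrt_le_sqrt
    calc z (p x) * d (p x) ≤ z x ^ 2 * (2 * d x - d x ^ 2) :=
          mul_le_mul (H.z_plus x) (H.d_plus x) (H.d_nonneg _) (sq_nonneg _)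
      _ = _ := by ring
  have h2 : √(z (m x) * d (m x)) ≤ √(z x * d x) * √(d x * (2 - z x)) := by
    rw [← Real.sqrt_mul (mul_nonneg hz hd)]
    apply Real.sqrt_le_sqrt
    calc z (m x) * d (m x) ≤ (2 * z x - z x ^ 2) * d x ^ 2 :=
          mul_le_mul (H.z_minus x) (H.d_minus x) (H.d_nonneg _)
            (by nlinarith [H.z_le_one x])
      _ = _ := by ring
  have h3 := mul_le_mul_of_nonneg_left (sqrt_add_sqrt_le hz hd (H.sq_add_sq x))
    (Real.sqrt_nonneg (z x * d x))
  simp only [branchMean]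
  linarith

theorem sqrt_iterate (H : IsPolarizing m p z d h) (n : ℕ) (x : X) :
    (branchMean m p)^[n] (fun y => √(z y * d y)) x ≤ (999 / 1000) ^ n := by
  have key : (branchMean m p)^[n] (fun y => √(z y * d y)) x ≤ √(z x * d x) * (999 / 1000) ^ n := by
    induction n with
    | zero => simp
    | succ n ih =>
      rw [Function.iterate_succ_apply]
      refine (branchMean_iterate_mono m p H.sqrt_step n x).trans ?_
      rw [branchMean_iterate_mul_const, pow_succ, ← mul_assoc]
      exact mul_le_mul_of_nonneg_right ih (by norm_num)
  have h1 : √(z x * d x) ≤ 1 :=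
    Real.sqrt_le_one.mpr (mul_le_one₀ (H.z_le_one x) (H.d_nonneg x) (H.d_le_one x))
  exact key.trans (mul_le_of_le_one_left (by positivity) h1)

/-- Slow polarization: apart from a fraction `h x` of the descendants and a small error, the
Bhattacharyya parameter is small. -/
theorem mean_bhattacharyya_gt (H : IsPolarizing m p z d h) {δ : ℝ} (hδ : 0 < δ) (n : ℕ) (x : X) :
    (branchMean m p)^[n] (fun y => if δ < z y then 1 else 0) x ≤
      h x + (3 * δ + (999 / 1000) ^ n * δ⁻¹) := by
  have hpt : ∀ y, (if δ < z y then (1 : ℝ) else 0) ≤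
      h y + (3 * δ + √(z y * d y) * δ⁻¹) := by
    intro y
    have h0 : 0 ≤ √(z y * d y) * δ⁻¹ := by positivity
    split_ifs with hy
    · by_cases hd : d y ≤ δ
      · linarith [H.one_sub_h_le y]
      · have h1 : δ ≤ √(z y * d y) := by
          apply Real.le_sqrt_of_sq_le
          nlinarith
        have h2 : 1 ≤ √(z y * d y) * δ⁻¹ := by
          rw [← div_eq_mul_inv, one_le_div hδ]
          exact h1
        linarith [H.h_nonneg y]
    · linarith [H.h_nonneg y]
  refine (branchMean_iterate_mono m p hpt n x).trans ?_
  rw [branchMean_iterate_add, branchMean_iterate_add, branchMean_iterate_of_harmonic m p H.harmonic,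
    branchMean_iterate_const, branchMean_iterate_mul_const]
  have := mul_le_mul_of_nonneg_right (H.sqrt_iterate n x) (inv_nonneg.mpr hδ.le)
  linarith

/-- Fast polarization: a Bhattacharyya parameter below `2 ^ (-(k + 1))` survives `k` steps of the
transform, being squared at about half of them. The invariant is that `z ≤ 2 ^ (-2 ^ o (k + 1))`
with `k` steps to go after `o` squarings; the bound is the exponential moment of `-o`. -/
theorem mean_tail (H : IsPolarizing m p z d h) {s : ℝ} (hs : 0 ≤ s) (θ : ℝ) (k : ℕ) :
    ∀ (o : ℝ), 0 ≤ o → ∀ x, z x ≤ (2 : ℝ) ^ (-((2 : ℝ) ^ o * (k + 1))) →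
      (branchMean m p)^[k] (fun y => if (2 : ℝ) ^ (-(2 : ℝ) ^ θ) < z y then 1 else 0) x ≤
        Real.exp (s * (θ - o)) * ((1 + Real.exp (-s)) / 2) ^ k := by
  induction k with
  | zero =>
    intro o ho x hx
    simp only [Function.iterate_zero, id_eq, pow_zero, mul_one]
    split_ifs with hz
    · apply Real.one_le_exp
      apply mul_nonneg hs
      have h1 := hz.trans_le hx
      rw [Real.rpow_lt_rpow_left_iff (by norm_num)] at h1
      have h2 : (2 : ℝ) ^ o < 2 ^ θ := by simpa using h1
      rw [Real.rpow_lt_rpow_left_iff (by norm_num)] at h2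
      linarith
    · positivity
  | succ k ih =>
    intro o ho x hx
    rw [branchMean_iterate_succ]
    have h2o : (1 : ℝ) ≤ 2 ^ o := Real.one_le_rpow (by norm_num) ho
    have hm := ih o ho (m x) (by
      calc z (m x) ≤ 2 * z x := by nlinarith [H.z_minus x, sq_nonneg (z x)]
        _ ≤ 2 ^ (1 : ℝ) * (2 : ℝ) ^ (-((2 : ℝ) ^ o * ((k + 1 : ℕ) + 1))) := by
          rw [Real.rpow_one]; linarith
        _ ≤ _ := by
          rw [← Real.rpow_add (by norm_num)]
          apply Real.rpow_le_rpow_of_exponent_le (by norm_num)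
          push_cast
          nlinarith)
    have hp := ih (o + 1) (by linarith) (p x) (by
      calc z (p x) ≤ z x ^ 2 := H.z_plus x
        _ ≤ ((2 : ℝ) ^ (-((2 : ℝ) ^ o * ((k + 1 : ℕ) + 1)))) ^ 2 :=
          pow_le_pow_left₀ (H.z_nonneg x) hx 2
        _ ≤ _ := by
          rw [sq, ← Real.rpow_add (by norm_num), Real.rpow_add_one (by norm_num)]
          apply Real.rpow_le_rpow_of_exponent_le (by norm_num)
          push_cast
          nlinarith)
    have he : Real.exp (s * (θ - (o + 1))) = Real.exp (s * (θ - o)) * Real.exp (-s) := by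
      rw [← Real.exp_add]
      ring_nf
    rw [he] at hp
    calc _ ≤ _ := div_le_div_of_nonneg_right (add_le_add hm hp) zero_le_two
      _ = _ := by ring

theorem mean_tail_half (H : IsPolarizing m p z d h) {ε : ℝ} (hε : 0 ≤ ε) (k : ℕ) (x : X)
    (hx : z x ≤ (2 : ℝ) ^ (-((k : ℝ) + 1))) :
    (branchMean m p)^[k]
        (fun y => if (2 : ℝ) ^ (-(2 : ℝ) ^ ((1 / 2 - ε) * (k : ℝ))) < z y then 1 else 0) x ≤
      Real.exp (-(2 * ε ^ 2)) ^ k := by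
  -- The exponent `s = 4 ε` minimizes `s² / 8 - s ε`.
  refine (H.mean_tail (s := 4 * ε) (by linarith) ((1 / 2 - ε) * k) k 0 le_rfl x
    (by simpa using hx)).trans ?_
  have h1 : Real.exp (4 * ε * ((1 / 2 - ε) * (k : ℝ) - 0)) =
      Real.exp (4 * ε * (1 / 2 - ε)) ^ k := by
    rw [← Real.exp_nat_mul]
    ring_nf
  rw [h1, ← mul_pow]
  apply pow_le_pow_left₀ (by positivity)
  have h2 := Real.cosh_le_exp_half_sq (2 * ε)
  rw [Real.cosh_eq] at h2
  have h3 : Real.exp (4 * ε * (1 / 2 - ε)) * ((1 + Real.exp (-(4 * ε))) / 2) =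
      Real.exp (-(4 * ε ^ 2)) * ((Real.exp (2 * ε) + Real.exp (-(2 * ε))) / 2) := by
    have e1 : Real.exp (4 * ε * (1 / 2 - ε)) = Real.exp (-(4 * ε ^ 2)) * Real.exp (2 * ε) := by
      rw [← Real.exp_add]; ring_nf
    have e2 : Real.exp (-(2 * ε)) = Real.exp (2 * ε) * Real.exp (-(4 * ε)) := by
      rw [← Real.exp_add]; ring_nf
    rw [e1, e2]
    ring
  rw [h3]
  calc _ ≤ Real.exp (-(4 * ε ^ 2)) * Real.exp ((2 * ε) ^ 2 / 2) :=
        mul_le_mul_of_nonneg_left h2 (Real.exp_pos _).le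
    _ = _ := by rw [← Real.exp_add]; ring_nf

/-- The three stages of polarization: after `a` steps most parameters that are going to vanish are
at most `2 ^ (-(k + 1))`; `k` more steps bring them down to `2 ^ (-(l + 1))`, and `l` further steps
to `2 ^ (-2 ^ ((1 / 2 - ε) l))`. -/
theorem mean_three_stages (H : IsPolarizing m p z d h) {ε : ℝ} (hε : 0 ≤ ε) (a k l : ℕ)
    (hkl : (l : ℝ) + 1 ≤ (2 : ℝ) ^ ((1 / 2 - ε) * (k : ℝ))) (x : X) :
    (branchMean m p)^[a + k + l]
        (fun y => if (2 : ℝ) ^ (-(2 : ℝ) ^ ((1 / 2 - ε) * (l : ℝ))) < z y then 1 else 0) x ≤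
      h x + (3 * (2 : ℝ) ^ (-((k : ℝ) + 1)) +
          (999 / 1000) ^ a * ((2 : ℝ) ^ (-((k : ℝ) + 1)))⁻¹) +
        Real.exp (-(2 * ε ^ 2)) ^ k + Real.exp (-(2 * ε ^ 2)) ^ l := by
  have split : ∀ (i : ℕ) (f : X → ℝ) (c t : ℝ), 0 ≤ c → (∀ y, f y ≤ 1) →
      (∀ y, z y ≤ t → (branchMean m p)^[i] f y ≤ c) →
      ∀ y, (branchMean m p)^[i] f y ≤ (if t < z y then 1 else 0) + c := by
    intro i f c t hc hf ht y
    split_ifs with hy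
    · have := branchMean_iterate_mono m p hf i y
      rw [branchMean_iterate_const] at this
      linarith
    · linarith [ht y (not_lt.mp hy)]
  have ind_le : ∀ (t : ℝ) y, (if t < z y then (1 : ℝ) else 0) ≤ 1 := by
    intro t y
    split_ifs <;> norm_num
  rw [Function.iterate_add_apply, Function.iterate_add_apply]
  have s1 := split l _ (Real.exp (-(2 * ε ^ 2)) ^ l) ((2 : ℝ) ^ (-((l : ℝ) + 1))) (by positivity)
    (ind_le _) (fun y hy => H.mean_tail_half hε l y hy)
  have s2 := split k _ (Real.exp (-(2 * ε ^ 2)) ^ k) ((2 : ℝ) ^ (-((k : ℝ) + 1))) (by positivity)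
    (ind_le ((2 : ℝ) ^ (-((l : ℝ) + 1)))) (fun y hy => by
      refine (branchMean_iterate_mono m p (fun w => ?_) k y).trans (H.mean_tail_half hε k y hy)
      have : (2 : ℝ) ^ (-(2 : ℝ) ^ ((1 / 2 - ε) * (k : ℝ))) ≤ (2 : ℝ) ^ (-((l : ℝ) + 1)) :=
        Real.rpow_le_rpow_of_exponent_le (by norm_num) (by linarith)
      split_ifs <;> first | (exfalso; linarith) | norm_num)
  have t1 : ∀ y, (branchMean m p)^[k] ((branchMean m p)^[l]
      (fun y => if (2 : ℝ) ^ (-(2 : ℝ) ^ ((1 / 2 - ε) * (l : ℝ))) < z y then 1 else 0)) y ≤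
      (if (2 : ℝ) ^ (-((k : ℝ) + 1)) < z y then 1 else 0) +
        (Real.exp (-(2 * ε ^ 2)) ^ k + Real.exp (-(2 * ε ^ 2)) ^ l) := by
    intro y
    refine (branchMean_iterate_mono m p s1 k y).trans ?_
    rw [branchMean_iterate_add, branchMean_iterate_const]
    linarith [s2 y]
  refine (branchMean_iterate_mono m p t1 a x).trans ?_
  rw [branchMean_iterate_add, branchMean_iterate_const]
  linarith [H.mean_bhattacharyya_gt (δ := (2 : ℝ) ^ (-((k : ℝ) + 1))) (by positivity) a x]

end IsPolarizing

/-- Polarization with its rate. The number `n` of steps does not depend on the process or on the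
node, so that one `n` serves several processes and their duals at once; the offset `n₀` is the
number of steps that precede the node. -/
theorem exists_mean_le {β : ℝ} (hβ : β < 1 / 2) {η : ℝ} (hη : 0 < η) (n₀ : ℕ) :
    ∃ n : ℕ, ∀ (X : Type*) (m p : X → X) (z d h : X → ℝ), IsPolarizing m p z d h → ∀ x,
      (branchMean m p)^[n]
          (fun y => if (2 : ℝ) ^ (-(((2 : ℝ) ^ (n₀ + n)) ^ β)) / 2 ≤ 3 * z y then 1 else 0) x ≤
        h x + η := by
  -- The three stages have `D (i + 1)`, `i` and `M i` steps, with `i` large. The choice of `D` makes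
  -- the potential `√(z d)` after the first stage negligible against the bound `2 ^ (-(i + 1))`
  -- required there; that of `M` makes the third stage long enough for the exponent `β` to hold
  -- relative to the total number of steps.
  obtain ⟨D, hD⟩ := exists_pow_lt_of_lt_one (show (0 : ℝ) < 1 / 4 by norm_num)
    (show (999 / 1000 : ℝ) < 1 by norm_num)
  obtain ⟨ε, hε, hε4, hβε⟩ : ∃ ε : ℝ, 0 < ε ∧ ε ≤ 1 / 4 ∧ β < 1 / 2 - ε :=
    ⟨min (1 / 4) ((1 / 2 - β) / 2), lt_min (by norm_num) (by linarith), min_le_left _ _, by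
      linarith [min_le_right (1 / 4) ((1 / 2 - β) / 2)]⟩
  set γ := 1 / 2 - ε with hγ
  obtain ⟨M, hM⟩ := exists_nat_ge ((|β| * (D + 1) + 1) / (γ - β) + 1)
  have hγβ : 0 < γ - β := by linarith
  have hM1 : (1 : ℝ) ≤ M := by
    have : 0 ≤ (|β| * (D + 1) + 1) / (γ - β) := by positivity
    linarith
  have hM2 : |β| * (D + 1) + 1 ≤ M * (γ - β) := by
    rw [← div_le_iff₀ hγβ]
    linarith
  set q := Real.exp (-(2 * ε ^ 2)) with hq
  have hq0 : 0 ≤ q := (Real.exp_pos _).le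
  have hq1 : q < 1 := by
    rw [hq, Real.exp_lt_one_iff]
    nlinarith
  have ev1 : ∀ᶠ i : ℕ in Filter.atTop, ((M * i : ℕ) : ℝ) + 1 ≤ (2 : ℝ) ^ (γ * (i : ℝ)) := by
    have hr : (1 : ℝ) < (2 : ℝ) ^ γ := Real.one_lt_rpow (by norm_num) (by linarith)
    have t1 := (tendsto_pow_const_div_const_pow_of_one_lt 1 hr).const_mul (M : ℝ)
    have t0 := tendsto_pow_const_div_const_pow_of_one_lt 0 hr
    have t := t1.add t0
    simp only [mul_zero, add_zero] at t
    filter_upwards [t.eventually_le_const (zero_lt_one)] with i hi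
    rw [Real.rpow_mul (by norm_num), Real.rpow_natCast]
    have hpos : (0 : ℝ) < ((2 : ℝ) ^ γ) ^ i := by positivity
    rw [pow_one, pow_zero, mul_div_assoc', ← add_div, div_le_one hpos] at hi
    push_cast
    exact hi
  have ev2 : ∀ᶠ i : ℕ in Filter.atTop, 12 + |β| * (n₀ + D) ≤ (i : ℝ) :=
    tendsto_natCast_atTop_atTop.eventually_ge_atTop _
  have ev3 : ∀ᶠ i : ℕ in Filter.atTop, 4 * (1 / 2 : ℝ) ^ (i + 1) + q ^ i + q ^ (M * i) ≤ η := by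
    have hM0 : M ≠ 0 := by
      rintro rfl
      norm_num at hM1
    have t1 : Filter.Tendsto (fun i : ℕ => 4 * (1 / 2 : ℝ) ^ (i + 1)) Filter.atTop
        (nhds (4 * 0)) :=
      ((tendsto_pow_atTop_nhds_zero_of_lt_one (by norm_num) (by norm_num)).comp
        (Filter.tendsto_add_atTop_nat 1)).const_mul 4
    have t2 := tendsto_pow_atTop_nhds_zero_of_lt_one hq0 hq1
    have t3 : Filter.Tendsto (fun i : ℕ => q ^ (M * i)) Filter.atTop (nhds 0) := by
      simp only [pow_mul]
      exact tendsto_pow_atTop_nhds_zero_of_lt_one (by positivity) (pow_lt_one₀ hq0 hq1 hM0)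
    have t := (t1.add t2).add t3
    simp only [mul_zero, add_zero] at t
    exact t.eventually_le_const hη
  obtain ⟨i, h1, h2, h3⟩ := (ev1.and (ev2.and ev3)).exists
  refine ⟨D * (i + 1) + i + M * i, fun X m p z d h H x => ?_⟩
  refine (branchMean_iterate_mono m p (fun y => ?_) _ x).trans
    ((H.mean_three_stages hε.le (D * (i + 1)) i (M * i) h1 x).trans ?_)
  · -- The target exponent `2 ^ (γ M i)` exceeds `(2 ^ N) ^ β` by more than the constant lost.
    set n := n₀ + (D * (i + 1) + i + M * i) with hn
    have hn' : (n : ℝ) = n₀ + (D * (i + 1) + i + M * i) := by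
      rw [hn]
      push_cast
      ring
    have e1 : ((2 : ℝ) ^ n) ^ β = (2 : ℝ) ^ (β * (n : ℝ)) := by
      rw [← Real.rpow_natCast, ← Real.rpow_mul (by norm_num), mul_comm]
    have hb1 := le_abs_self β
    have hb2 : 0 ≤ |β| := abs_nonneg β
    have hi0 : (0 : ℝ) ≤ i := Nat.cast_nonneg i
    have hn0 : (0 : ℝ) ≤ n₀ := Nat.cast_nonneg n₀
    have hD0 : (0 : ℝ) ≤ D := Nat.cast_nonneg D
    have i12 : (12 : ℝ) ≤ i := by nlinarith
    have g1 : β * n + 1 ≤ γ * (M * i : ℕ) := by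
      rw [hn']
      push_cast
      have a1 := mul_le_mul_of_nonneg_right hM2 hi0
      have a2 := mul_le_mul_of_nonneg_right hb1 (by positivity : 0 ≤ (D + 1) * (i : ℝ))
      have a3 := mul_le_mul_of_nonneg_right hb1 (by positivity : 0 ≤ (n₀ : ℝ) + D)
      nlinarith
    have g2 : 3 ≤ γ * (M * i : ℕ) := by
      push_cast
      have hγ4 : 1 / 4 ≤ γ := by linarith
      have : (12 : ℝ) ≤ M * i := by nlinarith
      nlinarith
    have g3 : (2 : ℝ) * 2 ^ (β * (n : ℝ)) ≤ 2 ^ (γ * ((M * i : ℕ) : ℝ)) := by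
      calc (2 : ℝ) * 2 ^ (β * (n : ℝ)) = 2 ^ (β * (n : ℝ) + 1) := by
            rw [Real.rpow_add_one (by norm_num), mul_comm]
        _ ≤ _ := Real.rpow_le_rpow_of_exponent_le (by norm_num) g1
    have g4 : (8 : ℝ) ≤ 2 ^ (γ * ((M * i : ℕ) : ℝ)) := by
      calc (8 : ℝ) = 2 ^ (3 : ℝ) := by norm_num
        _ ≤ _ := Real.rpow_le_rpow_of_exponent_le (by norm_num) g2
    have g5 : (2 : ℝ) ^ (-(2 : ℝ) ^ (γ * ((M * i : ℕ) : ℝ))) * 16 ≤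
        2 ^ (-(((2 : ℝ) ^ n) ^ β)) := by
      calc (2 : ℝ) ^ (-(2 : ℝ) ^ (γ * ((M * i : ℕ) : ℝ))) * 16 =
            2 ^ (-(2 : ℝ) ^ (γ * ((M * i : ℕ) : ℝ)) + 4) := by
            rw [Real.rpow_add (by norm_num)]
            norm_num
        _ ≤ _ := by
          apply Real.rpow_le_rpow_of_exponent_le (by norm_num)
          rw [e1]
          linarith
    have g6 : (0 : ℝ) < (2 : ℝ) ^ (-(2 : ℝ) ^ (γ * ((M * i : ℕ) : ℝ))) := by positivity
    split_ifs <;> first | (exfalso; linarith) | norm_num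
  · have e1 : (2 : ℝ) ^ (-((i : ℝ) + 1)) = (1 / 2 : ℝ) ^ (i + 1) := by
      rw [Real.rpow_neg (by norm_num), ← Nat.cast_add_one, Real.rpow_natCast, one_div, inv_pow]
    have e2 : (999 / 1000 : ℝ) ^ (D * (i + 1)) * ((1 / 2 : ℝ) ^ (i + 1))⁻¹ ≤
        (1 / 2 : ℝ) ^ (i + 1) := by
      rw [← div_eq_mul_inv, div_le_iff₀ (by positivity), ← mul_pow, pow_mul]
      exact pow_le_pow_left₀ (by positivity) (hD.le.trans (by norm_num)) _
    rw [e1]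
    linarith

/-! ### Probabilities and entropies on a finite sample space -/

section Probability

variable {Ω Ω' α β γ δ : Type*} [Fintype Ω] [Fintype Ω']

theorem prob_nonneg {μ : Ω → ℝ} (hμ : ∀ ω, 0 ≤ μ ω) (A : Ω → α) (a : α) : 0 ≤ prob μ A a :=
  Finset.sum_nonneg fun ω _ => hμ ω

theorem prob_congr {μ : Ω → ℝ} {A : Ω → α} {a : α} {B : Ω → β} {b : β}
    (h : ∀ ω, A ω = a ↔ B ω = b) : prob μ A a = prob μ B b := by
  classical
  unfold prob
  refine Finset.sum_congr ?_ fun _ _ => rfl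
  ext ω
  simp [h ω]

theorem sum_prob [Fintype α] (μ : Ω → ℝ) (A : Ω → α) : ∑ a, prob μ A a = ∑ ω, μ ω := by
  classical
  unfold prob
  convert Finset.sum_fiberwise (s := Finset.univ) A μ

theorem prob_eq_sum_prob_pair [Fintype α] (μ : Ω → ℝ) (A : Ω → α) (B : Ω → β) (b : β) :
    prob μ B b = ∑ a, prob μ (fun ω => (A ω, B ω)) (a, b) := by
  classical
  unfold prob
  rw [← Finset.sum_fiberwise (s := Finset.univ.filter fun ω => B ω = b) A μ]
  refine Finset.sum_congr rfl fun a _ => Finset.sum_congr ?_ fun _ _ => rfl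
  ext ω
  simp [and_comm]

theorem prob_comp_equiv (μ : Ω → ℝ) (e : Ω' ≃ Ω) (A : Ω → α) (a : α) :
    prob (fun ω => μ (e ω)) (fun ω => A (e ω)) a = prob μ A a := by
  classical
  unfold prob
  rw [Finset.sum_filter, Finset.sum_filter]
  exact e.sum_comp fun ω => if A ω = a then μ ω else 0

theorem prob_prod (μ : Ω → ℝ) (ν : Ω' → ℝ) (A : Ω → α) (B : Ω' → β) (a : α) (b : β) :
    prob (fun ω : Ω × Ω' => μ ω.1 * ν ω.2) (fun ω => (A ω.1, B ω.2)) (a, b) =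
      prob μ A a * prob ν B b := by
  classical
  unfold prob
  rw [Finset.sum_mul_sum, ← Finset.sum_product']
  refine Finset.sum_congr ?_ fun _ _ => rfl
  ext ω
  simp

open Classical in
/-- The right-hand side refers only to the partition of the sample space generated by `C`; the
values that `C` does not attain contribute `Ψ ∅ = 0` to the left-hand side. -/
theorem sum_fiber_eq_sum_image [Fintype γ] (Ψ : Finset Ω → ℝ) (h0 : Ψ ∅ = 0) (C : Ω → γ) :
    ∑ c, Ψ {ω | C ω = c} =
      ∑ S ∈ univ.image (fun ω => ({ω' | C ω' = C ω} : Finset Ω)), Ψ S := by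
  have e : univ.image (fun ω => ({ω' | C ω' = C ω} : Finset Ω)) =
      (univ.image C).image fun c => ({ω | C ω = c} : Finset Ω) := by
    rw [Finset.image_image]
    rfl
  rw [e, Finset.sum_image]
  · symm
    refine Finset.sum_subset (Finset.subset_univ _) fun c _ hc => ?_
    have : ({ω | C ω = c} : Finset Ω) = ∅ := by
      ext ω
      simp only [Finset.mem_filter, Finset.mem_univ, true_and, Finset.notMem_empty, iff_false]
      rintro rfl
      exact hc (Finset.mem_image_of_mem C (Finset.mem_univ ω))
    rw [this, h0]
  · intro c hc c' _ h
    obtain ⟨ω, -, rfl⟩ := Finset.mem_image.mp hc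
    have h' := Finset.ext_iff.mp h ω
    simpa using h'

open Classical in
/-- A sum over the values of `C` of a function of the event `C = c` depends only on the partition
of the sample space that `C` generates. -/
theorem sum_fiber_congr [Fintype γ] [Fintype δ] (Ψ : Finset Ω → ℝ) (h0 : Ψ ∅ = 0) (C : Ω → γ)
    (D : Ω → δ) (h : ∀ ω ω', C ω = C ω' ↔ D ω = D ω') :
    ∑ c, Ψ {ω | C ω = c} = ∑ d, Ψ {ω | D ω = d} := by
  rw [sum_fiber_eq_sum_image Ψ h0, sum_fiber_eq_sum_image Ψ h0]
  simp only [h]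

theorem entropy_congr [Fintype γ] [Fintype δ] (μ : Ω → ℝ) {C : Ω → γ} {D : Ω → δ}
    (h : ∀ ω ω', C ω = C ω' ↔ D ω = D ω') : entropy μ C = entropy μ D := by
  classical
  exact sum_fiber_congr (fun S => -((∑ ω ∈ S, μ ω) * Real.logb 2 (∑ ω ∈ S, μ ω))) (by simp) C D h

theorem entropy_comp_equiv [Fintype α] (μ : Ω → ℝ) (e : Ω' ≃ Ω) (A : Ω → α) :
    entropy (fun ω => μ (e ω)) (fun ω => A (e ω)) = entropy μ A := by
  simp only [entropy, prob_comp_equiv]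

/-- Entropy as the expectation of the surprise. -/
theorem entropy_eq_expectation [Fintype α] (μ : Ω → ℝ) (A : Ω → α) :
    entropy μ A = ∑ ω, -(μ ω * Real.logb 2 (prob μ A (A ω))) := by
  classical
  rw [entropy, ← Finset.sum_fiberwise (s := Finset.univ) A]
  refine Finset.sum_congr rfl fun a _ => ?_
  have : ∀ ω ∈ univ.filter (fun ω => A ω = a), -(μ ω * Real.logb 2 (prob μ A (A ω))) =
      μ ω * -Real.logb 2 (prob μ A a) := by
    intro ω hω
    rw [(Finset.mem_filter.mp hω).2]
    ring
  rw [Finset.sum_congr rfl this, ← Finset.sum_mul, mul_neg, neg_inj]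
  congr 1

theorem entropy_prod [Fintype α] [Fintype β] {μ : Ω → ℝ} {ν : Ω' → ℝ} (hμ1 : ∑ ω, μ ω = 1)
    (hν1 : ∑ ω, ν ω = 1) (A : Ω → α) (B : Ω' → β) :
    entropy (fun ω : Ω × Ω' => μ ω.1 * ν ω.2) (fun ω => (A ω.1, B ω.2)) =
      entropy μ A + entropy ν B := by
  have hA := sum_prob μ A
  have hB := sum_prob ν B
  rw [hμ1] at hA
  rw [hν1] at hB
  have key : ∀ x y : ℝ, -(x * y * Real.logb 2 (x * y)) =
      -(x * Real.logb 2 x) * y + x * -(y * Real.logb 2 y) := by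
    intro x y
    rcases eq_or_ne x 0 with rfl | hx
    · simp
    rcases eq_or_ne y 0 with rfl | hy
    · simp
    rw [Real.logb_mul hx hy]
    ring
  simp only [entropy, Fintype.sum_prod_type, prob_prod, key, Finset.sum_add_distrib]
  rw [← Finset.sum_mul_sum, ← Finset.sum_mul_sum, hA, hB]
  ring

end Probability

/-! ### Binary sources with side information -/

/-- The contribution to a conditional entropy of a value of the side information that has joint
probabilities `x` and `y` with the two values of the bit. -/
def binTerm (x y : ℝ) : ℝ :=
  -(x * Real.logb 2 x) + -(y * Real.logb 2 y) - -((x + y) * Real.logb 2 (x + y))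

theorem binTerm_comm (x y : ℝ) : binTerm x y = binTerm y x := by
  simp only [binTerm, add_comm]

theorem binTerm_zero (x : ℝ) : binTerm x 0 = 0 := by simp [binTerm]

theorem binTerm_eq (x y : ℝ) : binTerm x y =
    (x * (Real.log (x + y) - Real.log x) + y * (Real.log (x + y) - Real.log y)) / Real.log 2 := by
  simp only [binTerm, Real.logb]
  ring

/-- The binary entropy function is at least `2 t` for `t ≤ 1 / 2`, in homogeneous form. -/
theorem le_binTerm_aux {x y : ℝ} (hy : 0 ≤ y) (hxy : y ≤ x) : 2 * y ≤ binTerm x y := by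
  rcases hy.eq_or_lt with rfl | hy
  · simp [binTerm_zero]
  have hx : 0 < x := hy.trans_le hxy
  have hl : 0 < Real.log 2 := Real.log_pos (by norm_num)
  rw [binTerm_eq, le_div_iff₀ hl]
  have h1 : Real.log 2 ≤ Real.log (x + y) - Real.log y := by
    rw [← Real.log_div (by positivity) hy.ne']
    apply Real.log_le_log (by norm_num)
    rw [le_div_iff₀ hy]
    linarith
  have h2 : y / x * Real.log 2 ≤ Real.log (x + y) - Real.log x := by
    rw [← Real.log_div (by positivity) hx.ne', ← Real.log_rpow (by norm_num)]
    apply Real.log_le_log (by positivity)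
    have := rpow_one_add_le_one_add_mul_self (s := 1) (by norm_num) (p := y / x)
      (by positivity) ((div_le_one hx).mpr hxy)
    rw [add_div, div_self hx.ne']
    norm_num at this
    linarith
  have h3 := mul_le_mul_of_nonneg_left h1 hy.le
  have h4 := mul_le_mul_of_nonneg_left h2 hx.le
  have h5 : x * (y / x * Real.log 2) = y * Real.log 2 := by field_simp
  linarith

theorem le_binTerm {x y : ℝ} (hx : 0 ≤ x) (hy : 0 ≤ y) : x + y - |x - y| ≤ binTerm x y := by
  rcases le_total y x with h | h
  · rw [abs_of_nonneg (by linarith)]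
    linarith [le_binTerm_aux hy h]
  · rw [abs_of_nonpos (by linarith), binTerm_comm]
    linarith [le_binTerm_aux hx h]

theorem binTerm_nonneg {x y : ℝ} (hx : 0 ≤ x) (hy : 0 ≤ y) : 0 ≤ binTerm x y := by
  refine le_trans ?_ (le_binTerm hx hy)
  rw [sub_nonneg, abs_le]
  constructor <;> linarith

theorem binTerm_le {x y : ℝ} (hx : 0 ≤ x) (hy : 0 ≤ y) : binTerm x y ≤ x + y := by
  rcases hx.eq_or_lt with rfl | hx
  · rw [binTerm_comm, binTerm_zero]
    linarith
  rcases hy.eq_or_lt with rfl | hy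
  · rw [binTerm_zero]
    linarith
  have hl : 0 < Real.log 2 := Real.log_pos (by norm_num)
  have key : ∀ {t : ℝ}, 0 < t → t * (Real.log (x + y) - Real.log t) ≤
      (x + y) / 2 - t + t * Real.log 2 := by
    intro t ht
    have h1 := Real.log_le_sub_one_of_pos (show 0 < (x + y) / (2 * t) by positivity)
    rw [Real.log_div (by positivity) (by positivity), Real.log_mul (by norm_num) ht.ne'] at h1
    have h2 := mul_le_mul_of_nonneg_left h1 ht.le
    have h3 : t * ((x + y) / (2 * t) - 1) = (x + y) / 2 - t := by
      field_simp
    linarith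
  rw [binTerm_eq, div_le_iff₀ hl]
  linarith [key hx, key hy]

theorem binTerm_le_sqrt_aux {x y : ℝ} (hy : 0 ≤ y) (hxy : y ≤ x) :
    binTerm x y ≤ 6 * √(x * y) := by
  rcases hy.eq_or_lt with rfl | hy
  · simp [binTerm_zero]
  have hx : 0 < x := hy.trans_le hxy
  have hl : 0.69 < Real.log 2 := lt_trans (by norm_num) Real.log_two_gt_d9
  set r := √(x * y) with hr
  have hr0 : 0 ≤ r := Real.sqrt_nonneg _
  have hr2 : r ^ 2 = x * y := Real.sq_sqrt (by positivity)
  have h1 : x * (Real.log (x + y) - Real.log x) ≤ r := by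
    have := Real.log_le_sub_one_of_pos (show 0 < (x + y) / x by positivity)
    rw [Real.log_div (by positivity) hx.ne'] at this
    have h2 := mul_le_mul_of_nonneg_left this hx.le
    have h3 : x * ((x + y) / x - 1) = y := by
      field_simp
      ring
    have h4 : y ≤ r := Real.le_sqrt_of_sq_le (by nlinarith)
    linarith
  have h2 : y * (Real.log (x + y) - Real.log y) ≤ 3 * r := by
    -- `log t = 2 log √t ≤ 2 √t` at `t = (x + y) / y`
    have ht : 0 < (x + y) / y := by positivity
    have := Real.log_le_sub_one_of_pos (Real.sqrt_pos.mpr ht)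
    rw [Real.log_sqrt ht.le, Real.log_div (by positivity) hy.ne'] at this
    have h3 := mul_le_mul_of_nonneg_left this hy.le
    have h4 : y * √((x + y) / y) ≤ 3 / 2 * r := by
      apply le_of_sq_le_sq _ (by positivity)
      rw [mul_pow, Real.sq_sqrt ht.le, mul_pow, hr2]
      have : y ^ 2 * ((x + y) / y) = y * (x + y) := by field_simp
      nlinarith
    linarith
  rw [binTerm_eq, div_le_iff₀ (by linarith)]
  nlinarith

theorem binTerm_le_sqrt {x y : ℝ} (hx : 0 ≤ x) (hy : 0 ≤ y) : binTerm x y ≤ 6 * √(x * y) := by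
  rcases le_total y x with h | h
  · exact binTerm_le_sqrt_aux hy h
  · rw [binTerm_comm, mul_comm x y]
    exact binTerm_le_sqrt_aux hx h

theorem sum_zmod_two (f : ZMod 2 → ℝ) : ∑ a, f a = f 0 + f 1 := Fin.sum_univ_two f

section Source

variable {Ω γ δ : Type*} [Fintype Ω]

/-- The joint probability `P(A = a, C = c)` of a bit `A` and its side information `C`. -/
def joint (μ : Ω → ℝ) (A : Ω → ZMod 2) (C : Ω → γ) (a : ZMod 2) (c : γ) : ℝ :=
  prob μ (fun ω => (A ω, C ω)) (a, c)

/-- The Bhattacharyya parameter `2 ∑_c √(P(0, c) P(1, c))` of a bit `A` with side information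
`C`. -/
def bhattacharyya [Fintype γ] (μ : Ω → ℝ) (A : Ω → ZMod 2) (C : Ω → γ) : ℝ :=
  ∑ c, 2 * √(joint μ A C 0 c * joint μ A C 1 c)

/-- The variational distance `∑_c |P(0, c) - P(1, c)|` of a bit `A` with side information `C`. -/
def bias [Fintype γ] (μ : Ω → ℝ) (A : Ω → ZMod 2) (C : Ω → γ) : ℝ :=
  ∑ c, |joint μ A C 0 c - joint μ A C 1 c|

theorem joint_nonneg {μ : Ω → ℝ} (hμ : ∀ ω, 0 ≤ μ ω) (A : Ω → ZMod 2) (C : Ω → γ) (a : ZMod 2)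
    (c : γ) : 0 ≤ joint μ A C a c := prob_nonneg hμ _ _

theorem sum_joint [Fintype γ] (μ : Ω → ℝ) (A : Ω → ZMod 2) (C : Ω → γ) :
    ∑ c, (joint μ A C 0 c + joint μ A C 1 c) = ∑ ω, μ ω := by
  rw [← sum_prob μ C]
  refine Finset.sum_congr rfl fun c _ => ?_
  rw [prob_eq_sum_prob_pair μ A, sum_zmod_two]
  rfl

theorem condEntropy_eq_sum [Fintype γ] (μ : Ω → ℝ) (A : Ω → ZMod 2) (C : Ω → γ) :
    condEntropy μ A C = ∑ c, binTerm (joint μ A C 0 c) (joint μ A C 1 c) := by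
  simp only [condEntropy, entropy, Fintype.sum_prod_type, sum_zmod_two, binTerm,
    Finset.sum_sub_distrib, Finset.sum_add_distrib, prob_eq_sum_prob_pair μ A C]
  rfl

open Classical in
theorem joint_eq_sum (μ : Ω → ℝ) (A : Ω → ZMod 2) (C : Ω → γ) (a : ZMod 2) (c : γ) :
    joint μ A C a c = ∑ ω ∈ ({ω | C ω = c} : Finset Ω) with A ω = a, μ ω := by
  unfold joint prob
  refine Finset.sum_congr ?_ fun _ _ => rfl
  ext ω
  simp [and_comm]

theorem bhattacharyya_congr [Fintype γ] [Fintype δ] (μ : Ω → ℝ) (A : Ω → ZMod 2)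
    {C : Ω → γ} {D : Ω → δ} (h : ∀ ω ω', C ω = C ω' ↔ D ω = D ω') :
    bhattacharyya μ A C = bhattacharyya μ A D := by
  classical
  simp only [bhattacharyya, joint_eq_sum]
  exact sum_fiber_congr (fun S => 2 * √((∑ ω ∈ S with A ω = 0, μ ω) * ∑ ω ∈ S with A ω = 1, μ ω))
    (by simp) C D h

theorem bias_congr [Fintype γ] [Fintype δ] (μ : Ω → ℝ) (A : Ω → ZMod 2) {C : Ω → γ} {D : Ω → δ}
    (h : ∀ ω ω', C ω = C ω' ↔ D ω = D ω') : bias μ A C = bias μ A D := by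
  classical
  simp only [bias, joint_eq_sum]
  exact sum_fiber_congr (fun S => |(∑ ω ∈ S with A ω = 0, μ ω) - ∑ ω ∈ S with A ω = 1, μ ω|)
    (by simp) C D h

theorem bhattacharyya_comp_equiv [Fintype γ] {Ω' : Type*} [Fintype Ω'] (μ : Ω → ℝ) (e : Ω' ≃ Ω)
    (A : Ω → ZMod 2) (C : Ω → γ) :
    bhattacharyya (fun ω => μ (e ω)) (fun ω => A (e ω)) (fun ω => C (e ω)) =
      bhattacharyya μ A C := by
  simp only [bhattacharyya, joint, prob_comp_equiv μ e fun ω => (A ω, C ω)]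

theorem bias_comp_equiv [Fintype γ] {Ω' : Type*} [Fintype Ω'] (μ : Ω → ℝ) (e : Ω' ≃ Ω)
    (A : Ω → ZMod 2) (C : Ω → γ) :
    bias (fun ω => μ (e ω)) (fun ω => A (e ω)) (fun ω => C (e ω)) = bias μ A C := by
  simp only [bias, joint, prob_comp_equiv μ e fun ω => (A ω, C ω)]

theorem bhattacharyya_nonneg [Fintype γ] (μ : Ω → ℝ) (A : Ω → ZMod 2) (C : Ω → γ) :
    0 ≤ bhattacharyya μ A C := Finset.sum_nonneg fun _ _ => by positivity

theorem bias_nonneg [Fintype γ] (μ : Ω → ℝ) (A : Ω → ZMod 2) (C : Ω → γ) : 0 ≤ bias μ A C :=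
  Finset.sum_nonneg fun _ _ => abs_nonneg _

/-- The joint law after a step of type `+`: the bit `A₂` with side information
`(A₁ + A₂, C₁, C₂)`. -/
theorem joint_plus (μ : Ω → ℝ) (A : Ω → ZMod 2) (C : Ω → γ) (x u : ZMod 2) (c₁ c₂ : γ) :
    joint (fun ω : Ω × Ω => μ ω.1 * μ ω.2) (fun ω => A ω.2)
      (fun ω => (A ω.1 + A ω.2, C ω.1, C ω.2)) x (u, c₁, c₂) =
      joint μ A C (u - x) c₁ * joint μ A C x c₂ := by
  rw [joint, joint, joint, ← prob_prod]
  apply prob_congr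
  intro ω
  simp only [Prod.mk.injEq]
  constructor
  · rintro ⟨rfl, rfl, rfl, rfl⟩
    simp
  · rintro ⟨⟨h1, rfl⟩, rfl, rfl⟩
    simp [h1]

/-- The joint law after a step of type `-`: the bit `A₁ + A₂` with side information
`(C₁, C₂)`. -/
theorem joint_minus (μ : Ω → ℝ) (A : Ω → ZMod 2) (C : Ω → γ) (u : ZMod 2) (c₁ c₂ : γ) :
    joint (fun ω : Ω × Ω => μ ω.1 * μ ω.2) (fun ω => A ω.1 + A ω.2)
      (fun ω => (C ω.1, C ω.2)) u (c₁, c₂) =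
      joint μ A C u c₁ * joint μ A C 0 c₂ + joint μ A C (u - 1) c₁ * joint μ A C 1 c₂ := by
  rw [joint, prob_eq_sum_prob_pair _ (fun ω => A ω.2), sum_zmod_two]
  have h0 := joint_plus μ A C 0 u c₁ c₂
  have h1 := joint_plus μ A C 1 u c₁ c₂
  rw [sub_zero] at h0
  rw [← h0, ← h1]
  rfl

variable [Fintype γ] {μ : Ω → ℝ}

theorem condEntropy_nonneg (hμ : ∀ ω, 0 ≤ μ ω) (A : Ω → ZMod 2) (C : Ω → γ) :
    0 ≤ condEntropy μ A C := by
  rw [condEntropy_eq_sum]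
  exact Finset.sum_nonneg fun c _ => binTerm_nonneg (joint_nonneg hμ ..) (joint_nonneg hμ ..)

theorem condEntropy_le_one (hμ : ∀ ω, 0 ≤ μ ω) (hμ1 : ∑ ω, μ ω = 1) (A : Ω → ZMod 2)
    (C : Ω → γ) : condEntropy μ A C ≤ 1 := by
  rw [condEntropy_eq_sum, ← hμ1, ← sum_joint μ A C]
  exact Finset.sum_le_sum fun c _ => binTerm_le (joint_nonneg hμ ..) (joint_nonneg hμ ..)

theorem condEntropy_le_bhattacharyya (hμ : ∀ ω, 0 ≤ μ ω) (A : Ω → ZMod 2) (C : Ω → γ) :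
    condEntropy μ A C ≤ 3 * bhattacharyya μ A C := by
  rw [condEntropy_eq_sum, bhattacharyya, Finset.mul_sum]
  refine Finset.sum_le_sum fun c _ => ?_
  have := binTerm_le_sqrt (joint_nonneg hμ A C 0 c) (joint_nonneg hμ A C 1 c)
  linarith

theorem one_sub_condEntropy_le_bias (hμ : ∀ ω, 0 ≤ μ ω) (hμ1 : ∑ ω, μ ω = 1) (A : Ω → ZMod 2)
    (C : Ω → γ) : 1 - condEntropy μ A C ≤ bias μ A C := by
  rw [condEntropy_eq_sum, bias, ← hμ1, ← sum_joint μ A C, ← Finset.sum_sub_distrib]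
  refine Finset.sum_le_sum fun c _ => ?_
  have := le_binTerm (joint_nonneg hμ A C 0 c) (joint_nonneg hμ A C 1 c)
  linarith

theorem sq_bhattacharyya_add_sq_bias_le (hμ : ∀ ω, 0 ≤ μ ω) (hμ1 : ∑ ω, μ ω = 1)
    (A : Ω → ZMod 2) (C : Ω → γ) : bhattacharyya μ A C ^ 2 + bias μ A C ^ 2 ≤ 1 := by
  have hs := sum_joint μ A C
  rw [hμ1] at hs
  -- Cauchy-Schwarz for the factorization `4 x y = (x + y - |x - y|) (x + y + |x - y|)`
  have key := Finset.sum_sq_le_sum_mul_sum_of_sq_le_mul Finset.univ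
    (r := fun c => 2 * √(joint μ A C 0 c * joint μ A C 1 c))
    (f := fun c => joint μ A C 0 c + joint μ A C 1 c - |joint μ A C 0 c - joint μ A C 1 c|)
    (g := fun c => joint μ A C 0 c + joint μ A C 1 c + |joint μ A C 0 c - joint μ A C 1 c|)
    (fun c _ => by
      rw [sub_nonneg, abs_le]
      constructor <;> linarith [joint_nonneg hμ A C 0 c, joint_nonneg hμ A C 1 c])
    (fun c _ => by
      have := joint_nonneg hμ A C 0 c
      have := joint_nonneg hμ A C 1 c
      positivity)
    (fun c _ => by
      rw [mul_pow, Real.sq_sqrt (mul_nonneg (joint_nonneg hμ ..) (joint_nonneg hμ ..))]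
      have := sq_abs (joint μ A C 0 c - joint μ A C 1 c)
      linarith)
  rw [Finset.sum_sub_distrib, Finset.sum_add_distrib (g := fun c => |_|), hs] at key
  change bhattacharyya μ A C ^ 2 ≤ (1 - bias μ A C) * (1 + bias μ A C) at key
  linarith

/-! ### One step of the polar transform of a source -/

theorem bhattacharyya_plus (hμ : ∀ ω, 0 ≤ μ ω) (A : Ω → ZMod 2) (C : Ω → γ) :
    bhattacharyya (fun ω : Ω × Ω => μ ω.1 * μ ω.2) (fun ω => A ω.2)
      (fun ω => (A ω.1 + A ω.2, C ω.1, C ω.2)) = bhattacharyya μ A C ^ 2 := by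
  rw [sq, bhattacharyya, bhattacharyya, Fintype.sum_prod_type, sum_zmod_two,
    Fintype.sum_prod_type, Fintype.sum_prod_type, Finset.sum_mul_sum, ← Finset.sum_add_distrib]
  refine Finset.sum_congr rfl fun c₁ _ => ?_
  rw [← Finset.sum_add_distrib]
  refine Finset.sum_congr rfl fun c₂ _ => ?_
  simp only [joint_plus]
  have e1 : (0 - 1 : ZMod 2) = 1 := by decide
  rw [sub_zero, sub_zero, sub_self, e1]
  have e2 : ∀ a b c d : ℝ, 0 ≤ a → 0 ≤ b → √(a * c * (b * d)) = √(a * b) * √(c * d) := by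
    intro a b c d ha hb
    rw [← Real.sqrt_mul (mul_nonneg ha hb)]
    ring_nf
  rw [e2 _ _ _ _ (joint_nonneg hμ ..) (joint_nonneg hμ ..),
    e2 _ _ _ _ (joint_nonneg hμ ..) (joint_nonneg hμ ..), mul_comm (joint μ A C 1 c₁)]
  ring

/-- With `s = √(a₀ a₁)` and `t = √(b₀ b₁)`, the difference of the squares of the two sides is
`2 s t (a₀ + a₁ - 2 s) (b₀ + b₁ - 2 t)`. -/
theorem sqrt_minus_le {a₀ a₁ b₀ b₁ : ℝ} (ha₀ : 0 ≤ a₀) (ha₁ : 0 ≤ a₁) (hb₀ : 0 ≤ b₀)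
    (hb₁ : 0 ≤ b₁) :
    √((a₀ * b₀ + a₁ * b₁) * (a₁ * b₀ + a₀ * b₁)) ≤
      √(a₀ * a₁) * (b₀ + b₁) + (a₀ + a₁) * √(b₀ * b₁) - 2 * (√(a₀ * a₁) * √(b₀ * b₁)) := by
  have hs2 := Real.sq_sqrt (mul_nonneg ha₀ ha₁)
  have ht2 := Real.sq_sqrt (mul_nonneg hb₀ hb₁)
  have hs := Real.sqrt_nonneg (a₀ * a₁)
  have ht := Real.sqrt_nonneg (b₀ * b₁)
  set s := √(a₀ * a₁)
  set t := √(b₀ * b₁)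
  have hA : 0 ≤ a₀ + a₁ - 2 * s := by
    have : s ≤ (a₀ + a₁) / 2 := by
      apply le_of_sq_le_sq _ (by positivity)
      nlinarith [sq_nonneg (a₀ - a₁)]
    linarith
  have hB : 0 ≤ b₀ + b₁ - 2 * t := by
    have : t ≤ (b₀ + b₁) / 2 := by
      apply le_of_sq_le_sq _ (by positivity)
      nlinarith [sq_nonneg (b₀ - b₁)]
    linarith
  have hst : 0 ≤ s * t := mul_nonneg hs ht
  apply Real.sqrt_le_iff.mpr
  constructor
  · have h1 := mul_nonneg hs hB
    have h2 := mul_nonneg hA ht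
    linarith
  · have h1 : (a₀ * b₀ + a₁ * b₁) * (a₁ * b₀ + a₀ * b₁) =
        s ^ 2 * ((b₀ + b₁) ^ 2 - 2 * t ^ 2) + t ^ 2 * ((a₀ + a₁) ^ 2 - 2 * s ^ 2) := by
      rw [hs2, ht2]
      ring
    have h2 := mul_nonneg hst (mul_nonneg hA hB)
    rw [h1]
    linarith

theorem sum_sum_mix (f g : γ → ℝ) (hg : ∑ c, g c = 1) (k : ℝ) :
    ∑ c₁, ∑ c₂, (f c₁ * g c₂ + g c₁ * f c₂ - k * (f c₁ * f c₂)) =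
      2 * ∑ c, f c - k * (∑ c, f c) ^ 2 := by
  simp only [Finset.sum_sub_distrib, Finset.sum_add_distrib, ← Finset.mul_sum, ← Finset.sum_mul, hg]
  ring

theorem bhattacharyya_minus_le (hμ : ∀ ω, 0 ≤ μ ω) (hμ1 : ∑ ω, μ ω = 1) (A : Ω → ZMod 2)
    (C : Ω → γ) :
    bhattacharyya (fun ω : Ω × Ω => μ ω.1 * μ ω.2) (fun ω => A ω.1 + A ω.2)
      (fun ω => (C ω.1, C ω.2)) ≤ 2 * bhattacharyya μ A C - bhattacharyya μ A C ^ 2 := by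
  have hs := sum_joint μ A C
  rw [hμ1] at hs
  have key := sum_sum_mix (fun c => 2 * √(joint μ A C 0 c * joint μ A C 1 c)) _ hs 1
  rw [one_mul] at key
  refine le_trans ?_ key.le
  rw [bhattacharyya, Fintype.sum_prod_type]
  refine Finset.sum_le_sum fun c₁ _ => Finset.sum_le_sum fun c₂ _ => ?_
  rw [joint_minus, joint_minus]
  have e1 : (0 - 1 : ZMod 2) = 1 := by decide
  rw [sub_self, e1]
  have := sqrt_minus_le (joint_nonneg hμ A C 0 c₁) (joint_nonneg hμ A C 1 c₁)
    (joint_nonneg hμ A C 0 c₂) (joint_nonneg hμ A C 1 c₂)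
  linarith

theorem bias_minus (μ : Ω → ℝ) (A : Ω → ZMod 2) (C : Ω → γ) :
    bias (fun ω : Ω × Ω => μ ω.1 * μ ω.2) (fun ω => A ω.1 + A ω.2)
      (fun ω => (C ω.1, C ω.2)) = bias μ A C ^ 2 := by
  rw [sq, bias, bias, Fintype.sum_prod_type, Finset.sum_mul_sum]
  refine Finset.sum_congr rfl fun c₁ _ => Finset.sum_congr rfl fun c₂ _ => ?_
  rw [joint_minus, joint_minus, ← abs_mul]
  have e1 : (0 - 1 : ZMod 2) = 1 := by decide
  rw [sub_self, e1]
  ring_nf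

theorem abs_add_abs_plus_le {a₀ a₁ b₀ b₁ : ℝ} (ha₀ : 0 ≤ a₀) (ha₁ : 0 ≤ a₁) (hb₀ : 0 ≤ b₀)
    (hb₁ : 0 ≤ b₁) :
    |a₀ * b₀ - a₁ * b₁| + |a₁ * b₀ - a₀ * b₁| ≤
      |a₀ - a₁| * (b₀ + b₁) + (a₀ + a₁) * |b₀ - b₁| - |a₀ - a₁| * |b₀ - b₁| := by
  have hA : |a₀ - a₁| ≤ a₀ + a₁ := abs_le.mpr ⟨by linarith, by linarith⟩
  have hB : |b₀ - b₁| ≤ b₀ + b₁ := abs_le.mpr ⟨by linarith, by linarith⟩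
  have hA0 := abs_nonneg (a₀ - a₁)
  have hB0 := abs_nonneg (b₀ - b₁)
  -- the sum of absolute values is the larger of `|p + q|` and `|p - q|`
  have h1 : |(a₀ + a₁) * (b₀ - b₁)| ≤
      |a₀ - a₁| * (b₀ + b₁) + (a₀ + a₁) * |b₀ - b₁| - |a₀ - a₁| * |b₀ - b₁| := by
    rw [abs_mul, abs_of_nonneg (by linarith : 0 ≤ a₀ + a₁)]
    nlinarith
  have h2 : |(a₀ - a₁) * (b₀ + b₁)| ≤
      |a₀ - a₁| * (b₀ + b₁) + (a₀ + a₁) * |b₀ - b₁| - |a₀ - a₁| * |b₀ - b₁| := by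
    rw [abs_mul, abs_of_nonneg (by linarith : 0 ≤ b₀ + b₁)]
    nlinarith
  rw [abs_le] at h1 h2
  rcases abs_cases (a₀ * b₀ - a₁ * b₁) with ⟨h, -⟩ | ⟨h, -⟩ <;>
    rcases abs_cases (a₁ * b₀ - a₀ * b₁) with ⟨h', -⟩ | ⟨h', -⟩ <;> rw [h, h'] <;>
    linarith [h1.1, h1.2, h2.1, h2.2]

theorem bias_plus_le (hμ : ∀ ω, 0 ≤ μ ω) (hμ1 : ∑ ω, μ ω = 1) (A : Ω → ZMod 2) (C : Ω → γ) :
    bias (fun ω : Ω × Ω => μ ω.1 * μ ω.2) (fun ω => A ω.2)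
      (fun ω => (A ω.1 + A ω.2, C ω.1, C ω.2)) ≤ 2 * bias μ A C - bias μ A C ^ 2 := by
  have hs := sum_joint μ A C
  rw [hμ1] at hs
  have key := sum_sum_mix (fun c => |joint μ A C 0 c - joint μ A C 1 c|) _ hs 1
  rw [one_mul] at key
  refine le_trans ?_ key.le
  rw [bias, Fintype.sum_prod_type, sum_zmod_two, Fintype.sum_prod_type, Fintype.sum_prod_type,
    ← Finset.sum_add_distrib]
  refine Finset.sum_le_sum fun c₁ _ => ?_
  rw [← Finset.sum_add_distrib]
  refine Finset.sum_le_sum fun c₂ _ => ?_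
  simp only [joint_plus]
  have e1 : (0 - 1 : ZMod 2) = 1 := by decide
  rw [sub_zero, sub_zero, sub_self, e1]
  have := abs_add_abs_plus_le (joint_nonneg hμ A C 0 c₁) (joint_nonneg hμ A C 1 c₁)
    (joint_nonneg hμ A C 0 c₂) (joint_nonneg hμ A C 1 c₂)
  linarith

end Source

/-! ### Monotone lattice paths -/

section Walk

variable {ι : Type*} [DecidableEq ι]

/-- The unit step of user `i` from the lattice point `a`. -/
def step (a : ι → ℕ) (i : ι) : ι → ℕ := Function.update a i (a i + 1)

/-- The end of the lattice path that starts in `a` and has the steps `w`. -/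
def walkEnd (a : ι → ℕ) (w : List ι) : ι → ℕ := w.foldl step a

/-- The sum of `f b j`, over the steps of user `j` on the path with steps `w` from `a`, where `b`
is the point at which the step starts. -/
def walkSum (f : (ι → ℕ) → ι → ℝ) : (ι → ℕ) → List ι → ι → ℝ
  | _, [], _ => 0
  | a, i :: w, j => (if i = j then f a i else 0) + walkSum f (step a i) w j

/-- The increment of `F` along the step of user `i` from `a`. -/
def gain (F : (ι → ℕ) → ℝ) (a : ι → ℕ) (i : ι) : ℝ := F (step a i) - F a

theorem walkEnd_append (a : ι → ℕ) (v w : List ι) :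
    walkEnd a (v ++ w) = walkEnd (walkEnd a v) w := List.foldl_append

theorem walkSum_append (f : (ι → ℕ) → ι → ℝ) (a : ι → ℕ) (v w : List ι) (j : ι) :
    walkSum f a (v ++ w) j = walkSum f a v j + walkSum f (walkEnd a v) w j := by
  induction v generalizing a with
  | nil => simp [walkSum, walkEnd]
  | cons i v ih =>
    rw [List.cons_append, walkSum, walkSum, ih, add_assoc]
    rfl

theorem walkSum_eq_zero (f : (ι → ℕ) → ι → ℝ) (a : ι → ℕ) {w : List ι} {j : ι} (hj : j ∉ w) :
    walkSum f a w j = 0 := by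
  induction w generalizing a with
  | nil => rfl
  | cons i w ih =>
    rw [List.mem_cons, not_or] at hj
    rw [walkSum, if_neg (Ne.symm hj.1), ih _ hj.2, zero_add]

theorem walkEnd_apply (a : ι → ℕ) (w : List ι) (j : ι) : walkEnd a w j = a j + w.count j := by
  induction w generalizing a with
  | nil => rfl
  | cons i w ih =>
    change walkEnd (step a i) w j = _
    rw [ih, step, List.count_cons]
    by_cases h : i = j
    · subst h
      simp
      omega
    · simp [h, Function.update_of_ne (Ne.symm h)]

theorem walkEnd_replicate (a : ι → ℕ) (i : ι) (r : ℕ) :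
    walkEnd a (List.replicate r i) = Function.update a i (a i + r) := by
  funext j
  rw [walkEnd_apply]
  by_cases h : j = i
  · subst h
    simp
  · simp [List.count_replicate, h, Ne.symm h]

/-- Increments along a straight segment telescope. -/
theorem walkSum_replicate (F : (ι → ℕ) → ℝ) (a : ι → ℕ) (i : ι) (r : ℕ) :
    walkSum (gain F) a (List.replicate r i) i = F (Function.update a i (a i + r)) - F a := by
  induction r generalizing a with
  | zero => simp [walkSum]
  | succ r ih =>
    rw [List.replicate_succ, walkSum, if_pos rfl, ih, gain]
    have : Function.update (step a i) i (step a i i + r) =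
        Function.update a i (a i + (r + 1)) := by
      simp [step, add_assoc, add_comm 1 r]
    rw [this]
    ring

theorem count_of_walkEnd {a b : ι → ℕ} {w : List ι} (h : walkEnd a w = b) (j : ι) :
    a j + w.count j = b j := by rw [← walkEnd_apply, h]

/-- **Path lemma.** Let `F` change by at most `1` along unit steps, and let `R` lie, up to an error
`δ`, in the core `R(J) ≥ F(a with the coordinates in J moved to b) - F(a)`, `R(s) = F(b) - F(a)`.
Then some lattice path from `a` to `b` has increments of `F` close to `R`, user by user.

User `i` is advanced until the inequality for some `J ∌ i` is about to fail; there the problem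
splits into a problem for the users in `J` followed by one for the users in `s \ J`. -/
theorem exists_walk {F : (ι → ℕ) → ℝ} (hF : ∀ a i, |F (step a i) - F a| ≤ 1) (c : ℕ) :
    ∀ (s : Finset ι), s.card = c → ∀ (a b : ι → ℕ) (R : ι → ℝ) (δ : ℝ), 0 ≤ δ → a ≤ b →
      (∀ i ∉ s, a i = b i) → (∀ J ⊆ s, F (J.piecewise b a) - F a - δ ≤ ∑ j ∈ J, R j) →
      ∑ j ∈ s, R j ≤ F b - F a + δ →
      ∃ w : List ι, walkEnd a w = b ∧
        ∀ j ∈ s, |walkSum (gain F) a w j - R j| ≤ 3 ^ c * (δ + 1) := by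
  induction c using Nat.strong_induction_on with
  | _ c ih =>
  intro s hs a b R δ hδ hab hout hlow hupp
  have hsb : s.piecewise b a = b := by
    funext j
    by_cases hj : j ∈ s
    · simp [hj]
    · simp [hj, hout j hj]
  rcases s.eq_empty_or_nonempty with rfl | ⟨i, hi⟩
  · refine ⟨[], ?_, by simp⟩
    rw [← hsb]
    rfl
  have hc : 1 ≤ c := hs ▸ Finset.card_pos.mpr ⟨i, hi⟩
  have h3c : (3 : ℝ) ^ c = 3 * 3 ^ (c - 1) := by
    rw [← pow_succ', Nat.sub_add_cancel hc]
  have h3c1 : (1 : ℝ) ≤ 3 ^ (c - 1) := one_le_pow₀ (by norm_num)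
  by_cases hsing : s = {i}
  · -- a single user walks straight to the end
    subst hsing
    refine ⟨List.replicate (b i - a i) i, ?_, fun j hj => ?_⟩
    · rw [walkEnd_replicate, Nat.add_sub_cancel' (hab i)]
      funext j
      by_cases hj : j = i
      · subst hj
        simp
      · simpa [hj] using hout j (by simpa using hj)
    · rw [Finset.mem_singleton] at hj
      subst hj
      rw [walkSum_replicate, Nat.add_sub_cancel' (hab j)]
      have e : Function.update a j (b j) = b := by
        rw [← hsb]
        funext l
        by_cases hl : l = j
        · subst hl
          simp
        · simp [hl]
      have l1 := hlow {j} subset_rfl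
      rw [hsb, Finset.sum_singleton] at l1
      rw [Finset.sum_singleton] at hupp
      rw [e, abs_le]
      constructor <;> nlinarith
  -- the point reached after moving the coordinate of user `i` to `t`
  set pt : ℕ → ι → ℕ := fun t => Function.update a i t with hpt
  let P : ℕ → Prop := fun t => ∃ J ⊆ s.erase i, J.Nonempty ∧
    ∑ j ∈ J, R j ≤ F (J.piecewise b (pt t)) - F (pt t) + 2 * δ
  have hPb : P (b i) := by
    refine ⟨s.erase i, subset_rfl, ?_, ?_⟩
    · rw [Finset.erase_nonempty hi]
      exact (Finset.nontrivial_iff_ne_singleton hi).mpr hsing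
    · have e1 : (s.erase i).piecewise b (pt (b i)) = b := by
        rw [← hsb]
        funext j
        by_cases hj : j = i
        · subst hj
          simp [hpt, hi]
        · by_cases hjs : j ∈ s <;> simp [hpt, hj, hjs]
      have e2 : pt (b i) = ({i} : Finset ι).piecewise b a := by
        funext j
        by_cases hj : j = i
        · subst hj
          simp [hpt]
        · simp [hpt, hj]
      have l1 := hlow {i} (by simpa using hi)
      rw [← e2, Finset.sum_singleton] at l1
      have l2 := Finset.add_sum_erase s R hi
      rw [e1]
      linarith
  obtain ⟨t, hat0, htb, hPt, hmin⟩ : ∃ t, a i ≤ t ∧ t ≤ b i ∧ P t ∧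
      (t = a i ∨ ∃ t', t = t' + 1 ∧ ¬ P t') := by
    classical
    have hex : ∃ r, P (a i + r) := ⟨b i - a i, by rwa [Nat.add_sub_cancel' (hab i)]⟩
    refine ⟨a i + Nat.find hex, by omega, ?_, Nat.find_spec hex, ?_⟩
    · have := Nat.find_min' hex (m := b i - a i) (by rwa [Nat.add_sub_cancel' (hab i)])
      have hi' : a i ≤ b i := hab i
      omega
    · rcases hr : Nat.find hex with _ | r
      · exact Or.inl rfl
      · exact Or.inr ⟨a i + r, rfl, Nat.find_min hex (by omega)⟩
  -- up to `t` no inequality fails by more than `δ + 2`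
  have hlow' : ∀ J ⊆ s.erase i, F (J.piecewise b (pt t)) - F (pt t) - (δ + 2) ≤ ∑ j ∈ J, R j := by
    intro J hJ
    rcases hmin with rfl | ⟨t', rfl, ht'⟩
    · have := hlow J (hJ.trans (Finset.erase_subset _ _))
      simp only [hpt, Function.update_eq_self]
      linarith
    · rcases J.eq_empty_or_nonempty with rfl | hne
      · simp
        linarith
      · have h1 : F (J.piecewise b (pt t')) - F (pt t') + 2 * δ < ∑ j ∈ J, R j := by
          by_contra hcon
          exact ht' ⟨J, hJ, hne, not_lt.mp hcon⟩
        have e1 : pt (t' + 1) = step (pt t') i := by simp [hpt, step]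
        have hiJ : i ∉ J := fun h => Finset.notMem_erase i s (hJ h)
        have e2 : J.piecewise b (pt (t' + 1)) = step (J.piecewise b (pt t')) i := by
          funext j
          by_cases hj : j = i
          · subst hj
            simp [hpt, step, hiJ]
          · by_cases hjJ : j ∈ J <;> simp [hpt, step, hj, hjJ]
        have b1 := abs_le.mp (hF (pt t') i)
        have b2 := abs_le.mp (hF (J.piecewise b (pt t')) i)
        rw [e2, e1]
        linarith [b1.1, b1.2, b2.1, b2.2]
  obtain ⟨J, hJ, hJne, hJt⟩ := hPt
  have hiJ : i ∉ J := fun h => Finset.notMem_erase i s (hJ h)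
  have hJs : J ⊆ s := hJ.trans (Finset.erase_subset _ _)
  have hcard1 : J.card < c := by
    rw [← hs]
    exact Finset.card_lt_card ⟨hJs, fun h => hiJ (h hi)⟩
  have hcard2 : (s \ J).card < c := by
    rw [← hs]
    exact Finset.card_lt_card (Finset.sdiff_ssubset hJs hJne)
  set a₁ := pt t with ha₁
  set a₂ := J.piecewise b a₁ with ha₂
  -- the targets for the rest of the path: user `i` has already collected `F a₁ - F a`
  set R' : ι → ℝ := fun j => if j = i then R i - (F a₁ - F a) else R j with hR'
  have ha₁i : a₁ i = t := by simp [ha₁, hpt]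
  have ha₁j : ∀ j, j ≠ i → a₁ j = a j := fun j hj => by simp [ha₁, hpt, hj]
  have ha₁b : a₁ ≤ b := by
    intro j
    by_cases hj : j = i
    · subst hj
      rwa [ha₁i]
    · rw [ha₁j j hj]
      exact hab j
  obtain ⟨w₁, hw₁, hr₁⟩ := ih J.card hcard1 J rfl a₁ a₂ R (3 * δ + 2) (by linarith)
    (by
      intro j
      by_cases hj : j ∈ J
      · simpa [ha₂, hj] using ha₁b j
      · simp [ha₂, hj])
    (fun j hj => by simp [ha₂, hj])
    (by
      intro L hL
      have e : L.piecewise a₂ a₁ = L.piecewise b a₁ := by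
        funext j
        by_cases hj : j ∈ L
        · simp [ha₂, hj, hL hj]
        · simp [hj]
      rw [e]
      linarith [hlow' L (hL.trans hJ)])
    (by linarith)
  obtain ⟨w₂, hw₂, hr₂⟩ := ih (s \ J).card hcard2 (s \ J) rfl a₂ b R' (3 * δ + 2) (by linarith)
    (by
      intro j
      by_cases hj : j ∈ J
      · simp [ha₂, hj]
      · simpa [ha₂, hj] using ha₁b j)
    (by
      intro j hj
      by_cases hjJ : j ∈ J
      · simp [ha₂, hjJ]
      · have hjs : j ∉ s := fun h => hj (Finset.mem_sdiff.mpr ⟨h, hjJ⟩)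
        have hji : j ≠ i := fun h => hjs (h ▸ hi)
        simp [ha₂, hjJ, ha₁j j hji, hout j hjs])
    (by
      intro L hL
      have hLJ : Disjoint L J := Finset.disjoint_of_subset_left hL Finset.sdiff_disjoint
      have hLs : L ⊆ s := hL.trans Finset.sdiff_subset
      have hsum := Finset.sum_union (f := R) hLJ
      by_cases hiL : i ∈ L
      · have e1 : L.piecewise b a₂ = (L ∪ J).piecewise b a := by
          funext j
          by_cases hj : j ∈ L
          · simp [hj]
          · have hji : j ≠ i := fun h => hj (h ▸ hiL)
            by_cases hjJ : j ∈ J <;> simp [ha₂, hj, hjJ, ha₁j j hji]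
        have e2 : ∑ j ∈ L, R' j = ∑ j ∈ L, R j - (F a₁ - F a) := by
          rw [← Finset.add_sum_erase L R' hiL, ← Finset.add_sum_erase L R hiL]
          have : ∑ j ∈ L.erase i, R' j = ∑ j ∈ L.erase i, R j :=
            Finset.sum_congr rfl fun j hj => by simp [hR', Finset.ne_of_mem_erase hj]
          rw [this]
          simp only [hR', if_true]
          ring
        have l1 := hlow (L ∪ J) (Finset.union_subset hLs hJs)
        rw [e1, e2]
        linarith
      · have e1 : L.piecewise b a₂ = (L ∪ J).piecewise b a₁ := by
          funext j
          by_cases hj : j ∈ L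
          · simp [hj]
          · by_cases hjJ : j ∈ J <;> simp [ha₂, hj, hjJ]
        have e2 : ∑ j ∈ L, R' j = ∑ j ∈ L, R j :=
          Finset.sum_congr rfl fun j hj => by
            have : j ≠ i := fun h => hiL (h ▸ hj)
            simp [hR', this]
        have l1 := hlow' (L ∪ J) (by
          intro j hj
          refine Finset.mem_erase.mpr ⟨fun h => ?_, Finset.union_subset hLs hJs hj⟩
          rw [h, Finset.mem_union] at hj
          exact hj.elim hiL hiJ)
        rw [e1, e2]
        linarith)
    (by
      have e2 : ∑ j ∈ s \ J, R' j = ∑ j ∈ s \ J, R j - (F a₁ - F a) := by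
        have hiL : i ∈ s \ J := Finset.mem_sdiff.mpr ⟨hi, hiJ⟩
        rw [← Finset.add_sum_erase _ R' hiL, ← Finset.add_sum_erase _ R hiL]
        have : ∑ j ∈ (s \ J).erase i, R' j = ∑ j ∈ (s \ J).erase i, R j :=
          Finset.sum_congr rfl fun j hj => by simp [hR', Finset.ne_of_mem_erase hj]
        rw [this]
        simp only [hR', if_true]
        ring
      have l1 := Finset.sum_sdiff (f := R) hJs
      have l2 := hlow' J hJ
      rw [e2]
      linarith)
  have hw₀ : walkEnd a (List.replicate (t - a i) i) = a₁ := by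
    rw [walkEnd_replicate, Nat.add_sub_cancel' hat0]
  have h0 : walkSum (gain F) a (List.replicate (t - a i) i) i = F a₁ - F a := by
    rw [walkSum_replicate, Nat.add_sub_cancel' hat0]
  have bound : ∀ k < c, (3 : ℝ) ^ k * (3 * δ + 2 + 1) ≤ 3 ^ c * (δ + 1) := by
    intro k hk
    have : (3 : ℝ) ^ k ≤ 3 ^ (c - 1) := pow_le_pow_right₀ (by norm_num) (by omega)
    rw [h3c]
    nlinarith
  refine ⟨List.replicate (t - a i) i ++ (w₁ ++ w₂), ?_, fun j hj => ?_⟩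
  · rw [walkEnd_append, walkEnd_append, hw₀, hw₁, hw₂]
  · rw [walkSum_append, walkSum_append, hw₀, hw₁]
    by_cases hjJ : j ∈ J
    · have hji : j ≠ i := fun h => hiJ (h ▸ hjJ)
      have z0 : walkSum (gain F) a (List.replicate (t - a i) i) j = 0 :=
        walkSum_eq_zero _ _ fun h => hji (List.eq_of_mem_replicate h)
      have z2 : walkSum (gain F) a₂ w₂ j = 0 := by
        apply walkSum_eq_zero
        have := count_of_walkEnd hw₂ j
        rw [ha₂, Finset.piecewise_eq_of_mem _ _ _ hjJ] at this
        exact List.count_eq_zero.mp (by omega)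
      rw [z0, z2, zero_add, add_zero]
      exact (hr₁ j hjJ).trans (bound _ hcard1)
    · have z1 : walkSum (gain F) a₁ w₁ j = 0 := by
        apply walkSum_eq_zero
        have := count_of_walkEnd hw₁ j
        rw [ha₂, Finset.piecewise_eq_of_notMem _ _ _ hjJ] at this
        exact List.count_eq_zero.mp (by omega)
      have r2 := (hr₂ j (Finset.mem_sdiff.mpr ⟨hj, hjJ⟩)).trans (bound _ hcard2)
      rw [z1, zero_add]
      by_cases hji : j = i
      · subst hji
        rw [h0]
        simp only [hR', if_true] at r2
        have e : F a₁ - F a + walkSum (gain F) a₂ w₂ j - R j =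
            walkSum (gain F) a₂ w₂ j - (R j - (F a₁ - F a)) := by ring
        rw [e]
        exact r2
      · have z0 : walkSum (gain F) a (List.replicate (t - a i) i) j = 0 :=
          walkSum_eq_zero _ _ fun h => hji (List.eq_of_mem_replicate h)
        rw [z0, zero_add]
        simpa [hR', hji] using r2

end Walk

/-! ### Recursive structure of the polar transform -/

theorem bits_val (n : ℕ) (a : Fin (2 ^ n)) (t : Fin n) :
    (bits n a t : ℕ) = (a : ℕ) / 2 ^ (t : ℕ) % 2 := rfl

/-- The bit reversal reverses the digits of the column index. -/
theorem polarMatrix_apply (n : ℕ) (a b : Fin (2 ^ n)) :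
    polarMatrix n a b = ∏ t, kernel (bits n a t) (bits n b t.rev) := by
  have h : ∀ t, bits n ((bitReversal n).symm b) t = bits n b t.rev := by
    intro t
    simp [bits, bitReversal, Equiv.arrowCongr]
  rw [polarMatrix, Equiv.Perm.permMatrix, PEquiv.mul_toMatrix_toPEquiv, Matrix.submatrix_apply]
  simp only [kernelPow, Matrix.of_apply, id_eq, h]

/-- The indices of a block of length `2 ^ (n + 1)` as those of its two halves. -/
def halvesEquiv (n : ℕ) : Fin (2 ^ n) ⊕ Fin (2 ^ n) ≃ Fin (2 ^ (n + 1)) :=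
  finSumFinEquiv.trans (finCongr (by rw [pow_succ, mul_two]))

theorem halvesEquiv_inl_val (n : ℕ) (a : Fin (2 ^ n)) :
    (halvesEquiv n (Sum.inl a) : ℕ) = a := by
  simp [halvesEquiv]

theorem halvesEquiv_inr_val (n : ℕ) (a : Fin (2 ^ n)) :
    (halvesEquiv n (Sum.inr a) : ℕ) = a + 2 ^ n := by
  simp [halvesEquiv]

theorem bits_inl_castSucc (n : ℕ) (a : Fin (2 ^ n)) (t : Fin n) :
    bits (n + 1) (halvesEquiv n (Sum.inl a)) t.castSucc = bits n a t := by
  apply Fin.ext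
  rw [bits_val, bits_val, halvesEquiv_inl_val]
  rfl

theorem bits_inr_castSucc (n : ℕ) (a : Fin (2 ^ n)) (t : Fin n) :
    bits (n + 1) (halvesEquiv n (Sum.inr a)) t.castSucc = bits n a t := by
  apply Fin.ext
  rw [bits_val, bits_val, halvesEquiv_inr_val, Fin.val_castSucc]
  obtain ⟨r, hr⟩ : ∃ r, n = t + (r + 1) := ⟨n - t - 1, by have := t.isLt; omega⟩
  have : (2 : ℕ) ^ n = 2 ^ (t : ℕ) * (2 ^ r * 2) := by
    conv_lhs => rw [hr]
    ring
  rw [← Nat.add_mul_mod_self_right (a / 2 ^ (t : ℕ)) (2 ^ r) 2,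
    ← Nat.add_mul_div_left _ _ (by positivity), ← this]

theorem bits_inl_last (n : ℕ) (a : Fin (2 ^ n)) :
    bits (n + 1) (halvesEquiv n (Sum.inl a)) (Fin.last n) = 0 := by
  apply Fin.ext
  rw [bits_val, halvesEquiv_inl_val, Fin.val_last, Nat.div_eq_of_lt a.isLt]
  rfl

theorem bits_inr_last (n : ℕ) (a : Fin (2 ^ n)) :
    bits (n + 1) (halvesEquiv n (Sum.inr a)) (Fin.last n) = 1 := by
  apply Fin.ext
  rw [bits_val, halvesEquiv_inr_val, Fin.val_last, Nat.add_div_right _ (by positivity),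
    Nat.div_eq_of_lt a.isLt]
  rfl

theorem bits_two_mul_add_zero (n : ℕ) (b : Fin (2 ^ (n + 1))) (k : ℕ) (c : Fin 2)
    (hb : (b : ℕ) = 2 * k + c) : bits (n + 1) b 0 = c := by
  apply Fin.ext
  rw [bits_val, hb, Fin.val_zero, pow_zero, Nat.div_one, Nat.mul_add_mod]
  exact Nat.mod_eq_of_lt c.isLt

theorem bits_two_mul_add_succ (n : ℕ) (b : Fin (2 ^ (n + 1))) (k : Fin (2 ^ n)) (c : Fin 2)
    (hb : (b : ℕ) = 2 * k + c) (t : Fin n) : bits (n + 1) b t.succ = bits n k t := by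
  apply Fin.ext
  rw [bits_val, bits_val, hb, Fin.val_succ, pow_succ', ← Nat.div_div_eq_div_mul,
    Nat.mul_add_div (by norm_num), Nat.div_eq_of_lt c.isLt, add_zero]

theorem polarMatrix_inl (n : ℕ) (a k : Fin (2 ^ n)) (b : Fin (2 ^ (n + 1))) (c : Fin 2)
    (hb : (b : ℕ) = 2 * k + c) :
    polarMatrix (n + 1) (halvesEquiv n (Sum.inl a)) b = polarMatrix n a k * kernel 0 c := by
  rw [polarMatrix_apply, polarMatrix_apply, Fin.prod_univ_castSucc]
  simp only [bits_inl_castSucc, bits_inl_last, Fin.rev_castSucc, Fin.rev_last,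
    bits_two_mul_add_succ n b k c hb, bits_two_mul_add_zero n b k c hb]

theorem polarMatrix_inr (n : ℕ) (a k : Fin (2 ^ n)) (b : Fin (2 ^ (n + 1))) (c : Fin 2)
    (hb : (b : ℕ) = 2 * k + c) :
    polarMatrix (n + 1) (halvesEquiv n (Sum.inr a)) b = polarMatrix n a k * kernel 1 c := by
  rw [polarMatrix_apply, polarMatrix_apply, Fin.prod_univ_castSucc]
  simp only [bits_inr_castSucc, bits_inr_last, Fin.rev_castSucc, Fin.rev_last,
    bits_two_mul_add_succ n b k c hb, bits_two_mul_add_zero n b k c hb]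

/-- A block of length `2 ^ (n + 1)` as the pair of its two halves. -/
def blockHalves (n : ℕ) (α : Type*) :
    (Fin (2 ^ (n + 1)) → α) ≃ (Fin (2 ^ n) → α) × (Fin (2 ^ n) → α) :=
  (Equiv.arrowCongr (halvesEquiv n).symm (Equiv.refl α)).trans (Equiv.sumArrowEquivProdArrow _ _ _)

theorem blockHalves_fst (n : ℕ) {α : Type*} (ω : Fin (2 ^ (n + 1)) → α) (t : Fin (2 ^ n)) :
    (blockHalves n α ω).1 t = ω (halvesEquiv n (Sum.inl t)) := rfl

theorem blockHalves_snd (n : ℕ) {α : Type*} (ω : Fin (2 ^ (n + 1)) → α) (t : Fin (2 ^ n)) :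
    (blockHalves n α ω).2 t = ω (halvesEquiv n (Sum.inr t)) := rfl

section Transform

variable {K : ℕ} {𝒬 𝒴 : Type*}

/-- The symbol `U_{jk}` of the polar-transformed input of user `j`, with `k` any natural number;
it is `0` beyond the block length. -/
def symbol (n : ℕ) (j : Fin K) (k : ℕ) (ω : Fin (2 ^ n) → Letter K 𝒬 𝒴) : ZMod 2 :=
  if h : k < 2 ^ n then transformed ω j ⟨k, h⟩ else 0

/-- The top digit of the row index, which selects the half of the block, meets the lowest digit of
the column index. So the symbols `2 k` and `2 k + 1` of a block are the kernel transform of the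
symbols `k` of its two halves. -/
theorem transformed_succ (n : ℕ) (j : Fin K) (k : Fin (2 ^ n)) (b : Fin (2 ^ (n + 1))) (c : Fin 2)
    (hb : (b : ℕ) = 2 * k + c) (ω : Fin (2 ^ (n + 1)) → Letter K 𝒬 𝒴) :
    transformed ω j b = transformed (blockHalves n _ ω).1 j k * kernel 0 c +
      transformed (blockHalves n _ ω).2 j k * kernel 1 c := by
  simp only [transformed, Matrix.vecMul, dotProduct]
  rw [← (halvesEquiv n).sum_comp, Fintype.sum_sum_type, Finset.sum_mul, Finset.sum_mul]
  simp only [polarMatrix_inl n _ k b c hb, polarMatrix_inr n _ k b c hb, blockHalves_fst,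
    blockHalves_snd, mul_assoc]

theorem symbol_even (n : ℕ) (j : Fin K) (k : ℕ) (ω : Fin (2 ^ (n + 1)) → Letter K 𝒬 𝒴) :
    symbol (n + 1) j (2 * k) ω =
      symbol n j k (blockHalves n _ ω).1 + symbol n j k (blockHalves n _ ω).2 := by
  by_cases h : k < 2 ^ n
  · have h' : 2 * k < 2 ^ (n + 1) := by
      rw [pow_succ]
      omega
    rw [symbol, symbol, symbol, dif_pos h, dif_pos h, dif_pos h',
      transformed_succ n j ⟨k, h⟩ ⟨2 * k, h'⟩ 0 rfl]
    simp [kernel]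
  · have h' : ¬ 2 * k < 2 ^ (n + 1) := by
      rw [pow_succ]
      omega
    rw [symbol, symbol, symbol, dif_neg h, dif_neg h, dif_neg h', add_zero]

theorem symbol_odd (n : ℕ) (j : Fin K) (k : ℕ) (ω : Fin (2 ^ (n + 1)) → Letter K 𝒬 𝒴) :
    symbol (n + 1) j (2 * k + 1) ω = symbol n j k (blockHalves n _ ω).2 := by
  by_cases h : k < 2 ^ n
  · have h' : 2 * k + 1 < 2 ^ (n + 1) := by
      rw [pow_succ]
      omega
    rw [symbol, symbol, dif_pos h, dif_pos h',
      transformed_succ n j ⟨k, h⟩ ⟨2 * k + 1, h'⟩ 1 rfl]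
    simp [kernel]
  · have h' : ¬ 2 * k + 1 < 2 ^ (n + 1) := by
      rw [pow_succ]
      omega
    rw [symbol, symbol, dif_neg h, dif_neg h']

variable {𝒲 : Type*}

/-- The side information that consists of the symbols `U_{jk}`, `k < a j`, of all users and of the
function `W` of the letters of the block; symbols that are not included are replaced by `0`. -/
def prefixInfo (n : ℕ) (W : Letter K 𝒬 𝒴 → 𝒲) (a : Fin K → ℕ)
    (ω : Fin (2 ^ n) → Letter K 𝒬 𝒴) : (Fin K → Fin (2 ^ n) → ZMod 2) × (Fin (2 ^ n) → 𝒲) :=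
  (fun j k => if (k : ℕ) < a j then transformed ω j k else 0, fun t => W (ω t))

theorem prefixInfo_eq_iff {n : ℕ} {W : Letter K 𝒬 𝒴 → 𝒲} {a : Fin K → ℕ}
    {ω ω' : Fin (2 ^ n) → Letter K 𝒬 𝒴} : prefixInfo n W a ω = prefixInfo n W a ω' ↔
      (∀ j, ∀ k < a j, symbol n j k ω = symbol n j k ω') ∧ ∀ t, W (ω t) = W (ω' t) := by
  rw [prefixInfo, prefixInfo, Prod.mk.injEq]
  refine and_congr ⟨fun h j k hk => ?_, fun h => ?_⟩ funext_iff
  · by_cases hn : k < 2 ^ n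
    · have := congrFun (congrFun h j) ⟨k, hn⟩
      simpa [symbol, hk, hn] using this
    · simp [symbol, hn]
  · funext j k
    split_ifs with hk
    · simpa [symbol] using h j k hk
    · rfl

theorem prefixInfo_step_eq_iff {n : ℕ} {W : Letter K 𝒬 𝒴 → 𝒲} {a : Fin K → ℕ} {j : Fin K}
    {ω ω' : Fin (2 ^ n) → Letter K 𝒬 𝒴} :
    prefixInfo n W (step a j) ω = prefixInfo n W (step a j) ω' ↔
      symbol n j (a j) ω = symbol n j (a j) ω' ∧ prefixInfo n W a ω = prefixInfo n W a ω' := by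
  rw [prefixInfo_eq_iff, prefixInfo_eq_iff, ← and_assoc]
  refine and_congr_left fun _ => ⟨fun h => ⟨h j (a j) (by simp [step]), fun i k hk => h i k ?_⟩,
    fun ⟨h1, h2⟩ i k hk => ?_⟩
  · by_cases hi : i = j
    · subst hi
      simp only [step, Function.update_self]
      omega
    · simpa [step, hi] using hk
  · by_cases hi : i = j
    · subst hi
      simp only [step, Function.update_self] at hk
      rcases Nat.lt_succ_iff_lt_or_eq.mp hk with hk | rfl
      · exact h2 i k hk
      · exact h1
    · rw [step, Function.update_of_ne hi] at hk
      exact h2 i k hk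

theorem prefixInfo_double_eq_iff {n : ℕ} {W : Letter K 𝒬 𝒴 → 𝒲} {a : Fin K → ℕ}
    {ω ω' : Fin (2 ^ (n + 1)) → Letter K 𝒬 𝒴} :
    prefixInfo (n + 1) W (fun j => 2 * a j) ω = prefixInfo (n + 1) W (fun j => 2 * a j) ω' ↔
      prefixInfo n W a (blockHalves n _ ω).1 = prefixInfo n W a (blockHalves n _ ω').1 ∧
      prefixInfo n W a (blockHalves n _ ω).2 = prefixInfo n W a (blockHalves n _ ω').2 := by
  simp only [prefixInfo_eq_iff]
  have hW : (∀ t, W (ω t) = W (ω' t)) ↔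
      (∀ t, W ((blockHalves n _ ω).1 t) = W ((blockHalves n _ ω').1 t)) ∧
        ∀ t, W ((blockHalves n _ ω).2 t) = W ((blockHalves n _ ω').2 t) := by
    rw [← (halvesEquiv n).forall_congr_right, Sum.forall]
    rfl
  have hU : (∀ j, ∀ k < 2 * a j, symbol (n + 1) j k ω = symbol (n + 1) j k ω') ↔
      (∀ j, ∀ k < a j, symbol n j k (blockHalves n _ ω).1 = symbol n j k (blockHalves n _ ω').1) ∧
        ∀ j, ∀ k < a j,
          symbol n j k (blockHalves n _ ω).2 = symbol n j k (blockHalves n _ ω').2 := by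
    constructor
    · intro h
      have h2 : ∀ j, ∀ k < a j,
          symbol n j k (blockHalves n _ ω).2 = symbol n j k (blockHalves n _ ω').2 := by
        intro j k hk
        have := h j (2 * k + 1) (by omega)
        rwa [symbol_odd, symbol_odd] at this
      refine ⟨fun j k hk => ?_, h2⟩
      have := h j (2 * k) (by omega)
      rw [symbol_even, symbol_even, h2 j k hk] at this
      exact add_right_cancel this
    · rintro ⟨h1, h2⟩ j k hk
      rcases Nat.even_or_odd' k with ⟨r, rfl | rfl⟩
      · rw [symbol_even, symbol_even, h1 j r (by omega), h2 j r (by omega)]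
      · rw [symbol_odd, symbol_odd, h2 j r (by omega)]
  rw [hW, hU]
  tauto

/-- On the two halves of a block, the side information of the first descendant is that of a step of
type `-`. -/
theorem prefixInfo_minus_eq_iff {n : ℕ} {W : Letter K 𝒬 𝒴 → 𝒲} {a : Fin K → ℕ}
    (ω ω' : Fin (2 ^ (n + 1)) → Letter K 𝒬 𝒴) :
    prefixInfo (n + 1) W (fun j => 2 * a j) ω = prefixInfo (n + 1) W (fun j => 2 * a j) ω' ↔
      (fun ω : _ × _ => (prefixInfo n W a ω.1, prefixInfo n W a ω.2)) (blockHalves n _ ω) =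
      (fun ω : _ × _ => (prefixInfo n W a ω.1, prefixInfo n W a ω.2)) (blockHalves n _ ω') :=
  prefixInfo_double_eq_iff.trans Prod.mk_inj.symm

/-- On the two halves of a block, the side information of the second descendant is that of a step
of type `+`. -/
theorem prefixInfo_plus_eq_iff {n : ℕ} {W : Letter K 𝒬 𝒴 → 𝒲} {a : Fin K → ℕ} {j : Fin K}
    (ω ω' : Fin (2 ^ (n + 1)) → Letter K 𝒬 𝒴) :
    prefixInfo (n + 1) W (step (fun j => 2 * a j) j) ω =
        prefixInfo (n + 1) W (step (fun j => 2 * a j) j) ω' ↔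
      (fun ω : _ × _ => (symbol n j (a j) ω.1 + symbol n j (a j) ω.2, prefixInfo n W a ω.1,
        prefixInfo n W a ω.2)) (blockHalves n _ ω) =
      (fun ω : _ × _ => (symbol n j (a j) ω.1 + symbol n j (a j) ω.2, prefixInfo n W a ω.1,
        prefixInfo n W a ω.2)) (blockHalves n _ ω') := by
  rw [prefixInfo_step_eq_iff, prefixInfo_double_eq_iff, symbol_even, symbol_even]
  exact (and_congr_right fun _ => Prod.mk_inj.symm).trans Prod.mk_inj.symm

theorem symbol_minus (n : ℕ) (a : Fin K → ℕ) (j : Fin K) :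
    (symbol (n + 1) j (2 * a j) : (Fin (2 ^ (n + 1)) → Letter K 𝒬 𝒴) → ZMod 2) = fun ω =>
      (fun ω : _ × _ => symbol n j (a j) ω.1 + symbol n j (a j) ω.2) (blockHalves n _ ω) :=
  funext fun ω => symbol_even n j (a j) ω

theorem symbol_plus (n : ℕ) (a : Fin K → ℕ) (j : Fin K) :
    (symbol (n + 1) j (step (fun i => 2 * a i) j j) :
      (Fin (2 ^ (n + 1)) → Letter K 𝒬 𝒴) → ZMod 2) = fun ω =>
      (fun ω : _ × _ => symbol n j (a j) ω.2) (blockHalves n _ ω) := by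
  funext ω
  rw [step, Function.update_self]
  exact symbol_odd n j (a j) ω

end Transform

/-! ### Polarization along a multiple-access channel -/

theorem sum_pmf_toReal {α : Type*} [Fintype α] (p : PMF α) : ∑ a, (p a).toReal = 1 := by
  have h := p.tsum_coe
  rw [tsum_fintype] at h
  rw [← ENNReal.toReal_sum fun a _ => p.apply_ne_top a, h, ENNReal.toReal_one]

section Polarization

variable {K : ℕ} {𝒬 𝒴 : Type*} (p : MACLaw K 𝒬 𝒴)

theorem MACLaw.letterLaw_nonneg (ω : Letter K 𝒬 𝒴) : 0 ≤ p.letterLaw ω := by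
  unfold letterLaw
  have : 0 ≤ ∏ j, (p.input j ω.1 (ω.2.1 j)).toReal :=
    Finset.prod_nonneg fun j _ => ENNReal.toReal_nonneg
  positivity

theorem MACLaw.blockLaw_nonneg (N : ℕ) (ω : Fin N → Letter K 𝒬 𝒴) : 0 ≤ p.blockLaw N ω :=
  Finset.prod_nonneg fun _ _ => p.letterLaw_nonneg _

theorem MACLaw.blockLaw_succ (n : ℕ) : p.blockLaw (2 ^ (n + 1)) = fun ω =>
    p.blockLaw (2 ^ n) (blockHalves n _ ω).1 * p.blockLaw (2 ^ n) (blockHalves n _ ω).2 := by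
  funext ω
  unfold blockLaw
  rw [← (halvesEquiv n).prod_comp, Fintype.prod_sum_type]
  rfl

variable [Fintype 𝒬] [Fintype 𝒴]

theorem MACLaw.sum_letterLaw : ∑ ω, p.letterLaw ω = 1 := by
  simp only [Fintype.sum_prod_type, letterLaw, ← Finset.mul_sum, sum_pmf_toReal, mul_one]
  have : ∀ q, ∑ x : Fin K → ZMod 2, ∏ j, (p.input j q (x j)).toReal = 1 := by
    intro q
    rw [← Fintype.prod_sum fun j x => (p.input j q x).toReal]
    simp only [sum_pmf_toReal, Finset.prod_const_one]
  simp only [this, mul_one, sum_pmf_toReal]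

theorem MACLaw.sum_blockLaw (N : ℕ) : ∑ ω, p.blockLaw N ω = 1 := by
  unfold blockLaw
  rw [← Fintype.sum_pow, p.sum_letterLaw, one_pow]

variable {𝒲 : Type*} [Fintype 𝒲] (W : Letter K 𝒬 𝒴 → 𝒲)

/-- The entropy `H((U_{jk})_{k < a j}, W^N)`, with `N = 2 ^ n`. -/
def MACLaw.prefixEntropy (n : ℕ) (a : Fin K → ℕ) : ℝ :=
  entropy (p.blockLaw (2 ^ n)) (prefixInfo n W a)

theorem MACLaw.condEntropy_symbol (n : ℕ) (a : Fin K → ℕ) (j : Fin K) :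
    condEntropy (p.blockLaw (2 ^ n)) (symbol n j (a j)) (prefixInfo n W a) =
      gain (p.prefixEntropy W n) a j := by
  rw [condEntropy, gain, prefixEntropy, prefixEntropy]
  congr 1
  refine entropy_congr _ fun ω ω' => ?_
  rw [prefixInfo_step_eq_iff, Prod.mk.injEq]

theorem MACLaw.prefixEntropy_double (n : ℕ) (a : Fin K → ℕ) :
    p.prefixEntropy W (n + 1) (fun j => 2 * a j) = 2 * p.prefixEntropy W n a := by
  have h := entropy_prod (p.sum_blockLaw (2 ^ n)) (p.sum_blockLaw (2 ^ n))
    (prefixInfo n W a) (prefixInfo n W a)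
  rw [← entropy_comp_equiv _ (blockHalves n (Letter K 𝒬 𝒴)), ← p.blockLaw_succ] at h
  rw [two_mul, prefixEntropy, prefixEntropy, ← h]
  exact entropy_congr _ fun ω ω' => prefixInfo_double_eq_iff.trans Prod.mk_inj.symm

/-- The nodes of the polarization tree: the level `n`, a lattice point, and the user whose next
symbol is considered. -/
abbrev Node (K : ℕ) : Type := ℕ × (Fin K → ℕ) × Fin K

/-- The first of the two symbols into which the next symbol splits. -/
def Node.minus (x : Node K) : Node K := (x.1 + 1, fun i => 2 * x.2.1 i, x.2.2)

/-- The second of the two symbols into which the next symbol splits. -/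
def Node.plus (x : Node K) : Node K := (x.1 + 1, step (fun i => 2 * x.2.1 i) x.2.2, x.2.2)

/-- The Bhattacharyya parameter of the next symbol given the preceding ones and `W^N`. -/
def MACLaw.nodeBhattacharyya (x : Node K) : ℝ :=
  bhattacharyya (p.blockLaw (2 ^ x.1)) (symbol x.1 x.2.2 (x.2.1 x.2.2)) (prefixInfo x.1 W x.2.1)

/-- The variational distance of the next symbol given the preceding ones and `W^N`. -/
def MACLaw.nodeBias (x : Node K) : ℝ :=
  bias (p.blockLaw (2 ^ x.1)) (symbol x.1 x.2.2 (x.2.1 x.2.2)) (prefixInfo x.1 W x.2.1)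

/-- The conditional entropy of the next symbol given the preceding ones and `W^N`. -/
def MACLaw.nodeEntropy (x : Node K) : ℝ := gain (p.prefixEntropy W x.1) x.2.1 x.2.2

theorem MACLaw.nodeBhattacharyya_minus (n : ℕ) (a : Fin K → ℕ) (j : Fin K) :
    p.nodeBhattacharyya W (Node.minus (n, a, j)) =
      bhattacharyya (fun ω : _ × _ => p.blockLaw (2 ^ n) ω.1 * p.blockLaw (2 ^ n) ω.2)
        (fun ω => symbol n j (a j) ω.1 + symbol n j (a j) ω.2)
        (fun ω => (prefixInfo n W a ω.1, prefixInfo n W a ω.2)) := by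
  rw [← bhattacharyya_comp_equiv _ (blockHalves n (Letter K 𝒬 𝒴)), ← p.blockLaw_succ,
    ← symbol_minus]
  exact bhattacharyya_congr _ _ prefixInfo_minus_eq_iff

theorem MACLaw.nodeBhattacharyya_plus (n : ℕ) (a : Fin K → ℕ) (j : Fin K) :
    p.nodeBhattacharyya W (Node.plus (n, a, j)) =
      bhattacharyya (fun ω : _ × _ => p.blockLaw (2 ^ n) ω.1 * p.blockLaw (2 ^ n) ω.2)
        (fun ω => symbol n j (a j) ω.2)
        (fun ω => (symbol n j (a j) ω.1 + symbol n j (a j) ω.2, prefixInfo n W a ω.1,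
          prefixInfo n W a ω.2)) := by
  rw [← bhattacharyya_comp_equiv _ (blockHalves n (Letter K 𝒬 𝒴)), ← p.blockLaw_succ,
    ← symbol_plus]
  exact bhattacharyya_congr _ _ prefixInfo_plus_eq_iff

theorem MACLaw.nodeBias_minus (n : ℕ) (a : Fin K → ℕ) (j : Fin K) :
    p.nodeBias W (Node.minus (n, a, j)) =
      bias (fun ω : _ × _ => p.blockLaw (2 ^ n) ω.1 * p.blockLaw (2 ^ n) ω.2)
        (fun ω => symbol n j (a j) ω.1 + symbol n j (a j) ω.2)
        (fun ω => (prefixInfo n W a ω.1, prefixInfo n W a ω.2)) := by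
  rw [← bias_comp_equiv _ (blockHalves n (Letter K 𝒬 𝒴)), ← p.blockLaw_succ, ← symbol_minus]
  exact bias_congr _ _ prefixInfo_minus_eq_iff

theorem MACLaw.nodeBias_plus (n : ℕ) (a : Fin K → ℕ) (j : Fin K) :
    p.nodeBias W (Node.plus (n, a, j)) =
      bias (fun ω : _ × _ => p.blockLaw (2 ^ n) ω.1 * p.blockLaw (2 ^ n) ω.2)
        (fun ω => symbol n j (a j) ω.2)
        (fun ω => (symbol n j (a j) ω.1 + symbol n j (a j) ω.2, prefixInfo n W a ω.1,
          prefixInfo n W a ω.2)) := by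
  rw [← bias_comp_equiv _ (blockHalves n (Letter K 𝒬 𝒴)), ← p.blockLaw_succ, ← symbol_plus]
  exact bias_congr _ _ prefixInfo_plus_eq_iff

theorem step_step_double (a : Fin K → ℕ) (j : Fin K) :
    step (step (fun i => 2 * a i) j) j = fun i => 2 * step a j i := by
  funext i
  by_cases h : i = j
  · subst h
    simp [step]
    omega
  · simp [step, h]

theorem MACLaw.gain_double (n : ℕ) (a : Fin K → ℕ) (j : Fin K) :
    gain (p.prefixEntropy W (n + 1)) (fun i => 2 * a i) j +
      gain (p.prefixEntropy W (n + 1)) (step (fun i => 2 * a i) j) j =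
      2 * gain (p.prefixEntropy W n) a j := by
  rw [gain, gain, gain, step_step_double, p.prefixEntropy_double, p.prefixEntropy_double]
  ring

/-- The symbols along lattice paths polarize, for every `W` as side information. -/
theorem MACLaw.isPolarizing : IsPolarizing Node.minus Node.plus (p.nodeBhattacharyya W)
    (p.nodeBias W) (p.nodeEntropy W) where
  z_nonneg _ := bhattacharyya_nonneg ..
  d_nonneg _ := bias_nonneg ..
  h_nonneg x := by
    rw [nodeEntropy, ← condEntropy_symbol]
    exact condEntropy_nonneg (p.blockLaw_nonneg _) _ _
  h_le_one x := by
    rw [nodeEntropy, ← condEntropy_symbol]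
    exact condEntropy_le_one (p.blockLaw_nonneg _) (p.sum_blockLaw _) _ _
  z_minus x := by
    rw [p.nodeBhattacharyya_minus]
    exact bhattacharyya_minus_le (p.blockLaw_nonneg _) (p.sum_blockLaw _) _ _
  z_plus x := by
    rw [p.nodeBhattacharyya_plus]
    exact (bhattacharyya_plus (p.blockLaw_nonneg _) _ _).le
  d_minus x := by
    rw [p.nodeBias_minus]
    exact (bias_minus _ _ _).le
  d_plus x := by
    rw [p.nodeBias_plus]
    exact bias_plus_le (p.blockLaw_nonneg _) (p.sum_blockLaw _) _ _
  sq_add_sq _ := sq_bhattacharyya_add_sq_bias_le (p.blockLaw_nonneg _) (p.sum_blockLaw _) _ _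
  harmonic x := p.gain_double W x.1 x.2.1 x.2.2
  h_le x := by
    rw [nodeEntropy, ← condEntropy_symbol]
    exact condEntropy_le_bhattacharyya (p.blockLaw_nonneg _) _ _
  one_sub_h_le x := by
    rw [nodeEntropy, ← condEntropy_symbol]
    have h1 := one_sub_condEntropy_le_bias (p.blockLaw_nonneg (2 ^ x.1)) (p.sum_blockLaw _)
      (symbol x.1 x.2.2 (x.2.1 x.2.2)) (prefixInfo x.1 W x.2.1)
    have h2 := bias_nonneg (p.blockLaw (2 ^ x.1)) (symbol x.1 x.2.2 (x.2.1 x.2.2))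
      (prefixInfo x.1 W x.2.1)
    rw [nodeBias]
    linarith

end Polarization

/-! ### Refinement of lattice paths -/

section WalkSum

variable {ι : Type*} [DecidableEq ι]

theorem walkSum_mono {f g : (ι → ℕ) → ι → ℝ} (h : ∀ a i, f a i ≤ g a i) (a : ι → ℕ) (w : List ι)
    (j : ι) : walkSum f a w j ≤ walkSum g a w j := by
  induction w generalizing a with
  | nil => exact le_rfl
  | cons i w ih =>
    refine add_le_add ?_ (ih _)
    split_ifs
    · exact h a i
    · exact le_rfl

theorem walkSum_sub_const (f : (ι → ℕ) → ι → ℝ) (c : ℝ) (a : ι → ℕ) (w : List ι) (j : ι) :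
    walkSum (fun a i => f a i - c) a w j = walkSum f a w j - w.count j * c := by
  induction w generalizing a with
  | nil => simp [walkSum]
  | cons i w ih =>
    rw [walkSum, walkSum, ih, List.count_cons]
    by_cases h : i = j
    · simp [h]
      ring
    · simp [h]

/-- The sum along a path as a sum over the positions in its list of steps. -/
theorem walkSum_eq_sum (f : (ι → ℕ) → ι → ℝ) (a : ι → ℕ) (w : List ι) (j : ι) :
    walkSum f a w j = ∑ i : Fin w.length,
      if w.get i = j then f (walkEnd a (w.take i)) (w.get i) else 0 := by
  induction w generalizing a with
  | nil => rfl
  | cons i w ih =>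
    rw [walkSum, ih]
    exact (Fin.sum_univ_succ (n := w.length) fun r : Fin (w.length + 1) =>
      if (i :: w).get r = j then f (walkEnd a ((i :: w).take r)) ((i :: w).get r) else 0).symm

/-- The path in which every step is doubled. -/
def doubleSteps (w : List ι) : List ι := w.flatMap fun i => [i, i]

theorem count_doubleSteps (w : List ι) (j : ι) : (doubleSteps w).count j = 2 * w.count j := by
  induction w with
  | nil => rfl
  | cons i w ih =>
    change (i :: i :: doubleSteps w).count j = _
    rw [List.count_cons, List.count_cons, List.count_cons, ih]
    omega

theorem count_doubleSteps_iterate (w : List ι) (l : ℕ) (j : ι) :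
    (doubleSteps^[l] w).count j = 2 ^ l * w.count j := by
  induction l with
  | zero => simp
  | succ l ih =>
    rw [Function.iterate_succ_apply', count_doubleSteps, ih, pow_succ']
    ring

end WalkSum

section Refinement

variable {K : ℕ}

/-- Doubling the steps of a path at the next level averages over the two descendants of each
node. -/
theorem walkSum_doubleSteps (f : Node K → ℝ) (n : ℕ) (a : Fin K → ℕ) (w : List (Fin K))
    (j : Fin K) :
    walkSum (fun b i => f (n + 1, b, i)) (fun i => 2 * a i) (doubleSteps w) j =
      2 * walkSum (fun b i => branchMean Node.minus Node.plus f (n, b, i)) a w j := by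
  induction w generalizing a with
  | nil => simp [walkSum, doubleSteps]
  | cons i w ih =>
    change walkSum _ _ (i :: i :: doubleSteps w) j = _
    rw [walkSum, walkSum, walkSum, step_step_double, ih]
    split_ifs
    · simp only [branchMean, Node.minus, Node.plus]
      ring
    · ring

theorem walkSum_doubleSteps_iterate (f : Node K → ℝ) (n l : ℕ) (w : List (Fin K)) (j : Fin K) :
    walkSum (fun b i => f (n + l, b, i)) 0 (doubleSteps^[l] w) j =
      2 ^ l * walkSum (fun b i => (branchMean Node.minus Node.plus)^[l] f (n, b, i)) 0 w j := by
  induction l generalizing f with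
  | zero => simp
  | succ l ih =>
    have h := walkSum_doubleSteps f (n + l) 0 (doubleSteps^[l] w) j
    have e : (fun i : Fin K => 2 * (0 : Fin K → ℕ) i) = 0 := rfl
    rw [e, ih (branchMean Node.minus Node.plus f)] at h
    rw [Function.iterate_succ_apply', ← add_assoc, h, pow_succ']
    simp only [Function.iterate_succ_apply]
    ring

end Refinement

/-! ### The monotone permutation of a lattice path -/

section OfList

variable {K N : ℕ} (w : List (Fin K))

theorem length_of_count (hw : ∀ j, w.count j = N) : K * N = w.length := by
  have h := Multiset.sum_count_eq_card (s := Finset.univ) (m := (w : Multiset (Fin K)))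
    (fun _ _ => Finset.mem_univ _)
  simpa [hw] using h

theorem count_take_succ (i : Fin w.length) (j : Fin K) :
    (w.take (i + 1)).count j = (w.take i).count j + if w.get i = j then 1 else 0 := by
  rw [List.take_add_one, List.getElem?_eq_getElem i.isLt, List.count_append]
  simp [List.count_singleton]

theorem count_take_mono {i i' : ℕ} (h : i ≤ i') (j : Fin K) :
    (w.take i).count j ≤ (w.take i').count j :=
  (List.take_sublist_take_left h).count_le j

/-- At position `i` stands a symbol of user `j = w i`, whose index is the number of earlier steps
of that user. A position precedes `i` if and only if its symbol has been used up before `i`. -/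
theorem count_take_lt_iff (l i : Fin w.length) :
    (w.take l).count (w.get l) < (w.take i).count (w.get l) ↔ l < i := by
  constructor
  · intro h
    by_contra hli
    exact absurd h (not_lt.mpr (count_take_mono w (not_lt.mp hli) _))
  · intro h
    have h1 := count_take_succ w l (w.get l)
    rw [if_pos rfl] at h1
    have h2 := count_take_mono w (show (l : ℕ) + 1 ≤ i from h) (w.get l)
    omega

theorem count_take_lt (hw : ∀ j, w.count j = N) (i : Fin w.length) :
    (w.take i).count (w.get i) < N := by
  have h1 := count_take_succ w i (w.get i)
  rw [if_pos rfl] at h1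
  have h2 := (List.take_sublist (i + 1) w).count_le (w.get i)
  rw [hw] at h2
  omega

/-- The user and the index of the symbol in a given position of a lattice path. -/
def listSymbol (hw : ∀ j, w.count j = N) (i : Fin w.length) : Fin K × Fin N :=
  (w.get i, ⟨(w.take i).count (w.get i), count_take_lt w hw i⟩)

theorem listSymbol_injective (hw : ∀ j, w.count j = N) : Function.Injective (listSymbol w hw) := by
  intro l i h
  simp only [listSymbol, Prod.mk.injEq, Fin.mk.injEq] at h
  have h1 := count_take_lt_iff w l i
  have h2 := count_take_lt_iff w i l
  rw [h.1] at h1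
  rw [← h.2, h.1] at h2
  rw [h.1] at h
  rcases lt_trichotomy l i with hl | hl | hl
  · have := h1.mpr hl
    omega
  · exact hl
  · have := h2.mpr hl
    omega

/-- The monotone permutation whose order of symbols is given by a lattice path from `0` to
`(N, …, N)`. -/
def MonotonePermutation.ofList (hw : ∀ j, w.count j = N) : MonotonePermutation K N where
  toEquiv := (finCongr (length_of_count w hw)).trans (Equiv.ofBijective (listSymbol w hw) (by
    rw [Fintype.bijective_iff_injective_and_card]
    refine ⟨listSymbol_injective w hw, ?_⟩
    simp [← length_of_count w hw]))
  monotone j k l hkl := by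
    set e := Equiv.ofBijective (listSymbol w hw) _ with he
    have hk : listSymbol w hw (e.symm (j, k)) = (j, k) := e.apply_symm_apply _
    have hl : listSymbol w hw (e.symm (j, l)) = (j, l) := e.apply_symm_apply _
    change e.symm (j, k) < e.symm (j, l)
    simp only [listSymbol, Prod.mk.injEq] at hk hl
    rw [← count_take_lt_iff, hk.1]
    have h1 := congrArg Fin.val hk.2
    have h2 := congrArg Fin.val hl.2
    simp only [hk.1, hl.1] at h1 h2
    rw [h1, h2]
    exact hkl

end OfList

section Rates

variable {K : ℕ} {𝒬 𝒴 : Type*} {n : ℕ} (w : List (Fin K))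

theorem permuted_ofList (hw : ∀ j, w.count j = 2 ^ n) (i : Fin (K * 2 ^ n)) :
    (fun ω : Fin (2 ^ n) → Letter K 𝒬 𝒴 => permuted (MonotonePermutation.ofList w hw) ω i) =
      symbol n (w.get (finCongr (length_of_count w hw) i))
        (walkEnd 0 (w.take i) (w.get (finCongr (length_of_count w hw) i))) := by
  funext ω
  rw [walkEnd_apply, Pi.zero_apply, zero_add]
  have h : (w.take i).count (w.get (finCongr (length_of_count w hw) i)) < 2 ^ n :=
    count_take_lt w hw (finCongr (length_of_count w hw) i)
  rw [symbol, dif_pos h]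
  rfl

/-- The symbols that precede position `i` are those below the `i`-th point of the path. -/
theorem permuted_eq_iff (hw : ∀ j, w.count j = 2 ^ n) (i : Fin (K * 2 ^ n))
    (ω ω' : Fin (2 ^ n) → Letter K 𝒬 𝒴) :
    ((fun l : {l // l < i} => permuted (MonotonePermutation.ofList w hw) ω l) =
      fun l : {l // l < i} => permuted (MonotonePermutation.ofList w hw) ω' l) ↔
      ∀ j, ∀ k < walkEnd 0 (w.take i) j, symbol n j k ω = symbol n j k ω' := by
  set e := finCongr (length_of_count w hw) with he
  rw [funext_iff]
  constructor
  · intro h j k hk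
    rw [walkEnd_apply, Pi.zero_apply, zero_add] at hk
    have hkN : k < 2 ^ n := by
      have := (List.take_sublist i w).count_le j
      rw [hw] at this
      omega
    obtain ⟨l, hl⟩ := (MonotonePermutation.ofList w hw).toEquiv.surjective (j, ⟨k, hkN⟩)
    have hl1 : w.get (e l) = j := congrArg Prod.fst hl
    have hl2 : (w.take l).count (w.get (e l)) = k := congrArg (fun x => (x.2 : ℕ)) hl
    have hli : l < i := by
      apply (count_take_lt_iff w (e l) (e i)).mp
      rw [hl1] at hl2 ⊢
      exact hl2.trans_lt hk
    have := h ⟨l, hli⟩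
    simpa only [permuted, hl, symbol, dif_pos hkN] using this
  · rintro h ⟨l, hl⟩
    have e1 := congrFun (permuted_ofList (𝒬 := 𝒬) (𝒴 := 𝒴) w hw l)
    rw [e1, e1]
    apply h
    rw [walkEnd_apply, walkEnd_apply, Pi.zero_apply, zero_add, zero_add]
    exact (count_take_lt_iff w (e l) (e i)).mpr hl

variable [Fintype 𝒬] [Fintype 𝒴] (p : MACLaw K 𝒬 𝒴)

theorem condEntropy_congr {Ω α γ δ : Type*} [Fintype Ω] [Fintype α] [Fintype γ] [Fintype δ]
    (μ : Ω → ℝ) (A : Ω → α) {C : Ω → γ} {D : Ω → δ} (h : ∀ ω ω', C ω = C ω' ↔ D ω = D ω') :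
    condEntropy μ A C = condEntropy μ A D := by
  rw [condEntropy, condEntropy, entropy_congr μ h]
  congr 1
  refine entropy_congr μ fun ω ω' => ?_
  rw [Prod.mk.injEq, Prod.mk.injEq, h]

/-- The time-sharing variable of a letter. -/
def letterQ (ω : Letter K 𝒬 𝒴) : 𝒬 := ω.1

/-- The time-sharing variable and the channel output of a letter. -/
def letterQY (ω : Letter K 𝒬 𝒴) : 𝒬 × 𝒴 := (ω.1, ω.2.2)

/-- Up to a constant, `I((U_{jk})_{k < a j}; Y^N | Q^N)`. -/
def MACLaw.prefixInformation (n : ℕ) (a : Fin K → ℕ) : ℝ :=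
  p.prefixEntropy letterQ n a - p.prefixEntropy letterQY n a

/-- `I(U; Y^N | C, Q^N)` for the next symbol `U` at a node and the preceding symbols `C`. -/
def MACLaw.nodeInformation (x : Node K) : ℝ := p.nodeEntropy letterQ x - p.nodeEntropy letterQY x

theorem MACLaw.gain_prefixInformation (a : Fin K → ℕ) (j : Fin K) :
    gain (p.prefixInformation n) a j = p.nodeInformation (n, a, j) := by
  simp only [gain, prefixInformation, nodeInformation, nodeEntropy]
  ring

theorem MACLaw.indexInfo_ofList (hw : ∀ j, w.count j = 2 ^ n) (i : Fin (K * 2 ^ n)) :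
    p.indexInfo (MonotonePermutation.ofList w hw) i =
      p.nodeInformation (n, walkEnd 0 (w.take i), w.get (finCongr (length_of_count w hw) i)) := by
  rw [nodeInformation, nodeEntropy, nodeEntropy, ← condEntropy_symbol, ← condEntropy_symbol,
    indexInfo, condMutualInfo]
  simp only
  rw [permuted_ofList]
  congr 1
  · refine condEntropy_congr _ _ fun ω ω' => ?_
    rw [prefixInfo_eq_iff, Prod.mk.injEq, permuted_eq_iff, funext_iff]
    rfl
  · refine condEntropy_congr _ _ fun ω ω' => ?_
    rw [prefixInfo_eq_iff, Prod.mk.injEq, Prod.mk.injEq, permuted_eq_iff, funext_iff, funext_iff]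
    simp only [letterQY, Prod.mk.injEq, forall_and]
    tauto

theorem sum_positions_ofList (hw : ∀ j, w.count j = 2 ^ n) (f : Node K → ℝ) (j : Fin K) :
    ∑ i ∈ (MonotonePermutation.ofList w hw).positions j,
      f (n, walkEnd 0 (w.take i), w.get (finCongr (length_of_count w hw) i)) =
      walkSum (fun b i => f (n, b, i)) 0 w j := by
  rw [walkSum_eq_sum, MonotonePermutation.positions, Finset.sum_filter,
    ← (finCongr (length_of_count w hw)).sum_comp]
  rfl

theorem MACLaw.rate_ofList (hw : ∀ j, w.count j = 2 ^ n) (j : Fin K) :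
    p.rate (MonotonePermutation.ofList w hw) j =
      1 / (2 ^ n : ℝ) * walkSum (fun b i => p.nodeInformation (n, b, i)) 0 w j := by
  rw [rate, ← sum_positions_ofList w hw]
  simp only [p.indexInfo_ofList w hw]

open Classical in
theorem MACLaw.card_goodIndices_ofList (hw : ∀ j, w.count j = 2 ^ n) (β : ℝ) (j : Fin K) :
    ((p.goodIndices (MonotonePermutation.ofList w hw) β j).card : ℝ) =
      walkSum (fun b i => if 1 - (2 : ℝ) ^ (-(((2 : ℝ) ^ n) ^ β)) < p.nodeInformation (n, b, i)
        then 1 else 0) 0 w j := by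
  rw [goodIndices, Finset.card_filter, Nat.cast_sum, ← sum_positions_ofList w hw fun x =>
    if 1 - (2 : ℝ) ^ (-(((2 : ℝ) ^ n) ^ β)) < p.nodeInformation x then (1 : ℝ) else 0]
  simp only [p.indexInfo_ofList w hw, gt_iff_lt, Nat.cast_ite, Nat.cast_one, Nat.cast_zero]

end Rates

/-! ### The dominant face at the level of single letters -/

section Face

variable {K : ℕ} {𝒬 𝒴 : Type*}

/-- The inputs of the users in `J`, with those of the other users replaced by `0`. -/
def maskedInput (J : Finset (Fin K)) (ω : Letter K 𝒬 𝒴) (j : Fin K) : ZMod 2 :=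
  if j ∈ J then ω.2.1 j else 0

theorem maskedInput_eq_iff {J : Finset (Fin K)} {ω ω' : Letter K 𝒬 𝒴} :
    maskedInput J ω = maskedInput J ω' ↔ ∀ j ∈ J, ω.2.1 j = ω'.2.1 j := by
  rw [funext_iff]
  refine forall_congr' fun j => ?_
  by_cases h : j ∈ J <;> simp [maskedInput, h]

theorem restrict_eq_iff {J : Finset (Fin K)} {ω ω' : Letter K 𝒬 𝒴} :
    ((fun j : {j // j ∈ J} => ω.2.1 j) = fun j : {j // j ∈ J} => ω'.2.1 j) ↔
      ∀ j ∈ J, ω.2.1 j = ω'.2.1 j := by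
  rw [funext_iff, Subtype.forall]

theorem symbol_zero (j : Fin K) (ω : Fin (2 ^ 0) → Letter K 𝒬 𝒴) :
    symbol 0 j 0 ω = (ω 0).2.1 j := by
  rw [symbol, dif_pos (by norm_num)]
  simp only [transformed, Matrix.vecMul, dotProduct, polarMatrix_apply]
  rw [Fintype.sum_eq_single (0 : Fin (2 ^ 0)) fun t ht =>
    absurd (Subsingleton.elim (α := Fin 1) t 0) ht]
  simp

variable [Fintype 𝒬] [Fintype 𝒴] (p : MACLaw K 𝒬 𝒴)

/-- The entropy `H(X_J, W)` of the inputs of the users in `J` and a function `W` of the letter. -/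
def MACLaw.letterEntropy {𝒲 : Type*} [Fintype 𝒲] (W : Letter K 𝒬 𝒴 → 𝒲) (J : Finset (Fin K)) :
    ℝ :=
  entropy p.letterLaw fun ω => (maskedInput J ω, W ω)

/-- The corner of the cube `[0, N] ^ K` that belongs to a set `J` of users. -/
def corner (N : ℕ) (J : Finset (Fin K)) : Fin K → ℕ := J.piecewise (fun _ => N) 0

theorem MACLaw.prefixEntropy_zero {𝒲 : Type*} [Fintype 𝒲] (W : Letter K 𝒬 𝒴 → 𝒲)
    (J : Finset (Fin K)) : p.prefixEntropy W 0 (corner 1 J) = p.letterEntropy W J := by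
  have hlaw : p.blockLaw (2 ^ 0) = fun ω => p.letterLaw (Equiv.funUnique (Fin 1) _ ω) := by
    funext ω
    exact Fin.prod_univ_one fun t => p.letterLaw (ω t)
  have h := entropy_comp_equiv p.letterLaw (Equiv.funUnique (Fin 1) (Letter K 𝒬 𝒴))
    fun ω => (maskedInput J ω, W ω)
  rw [letterEntropy, ← h, prefixEntropy, hlaw]
  refine entropy_congr _ fun ω ω' => ?_
  rw [prefixInfo_eq_iff, Prod.mk.injEq, maskedInput_eq_iff]
  refine and_congr (forall_congr' fun j => ?_) ⟨fun h => h 0, fun h t => ?_⟩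
  · by_cases hj : j ∈ J
    · simp only [corner, hj, Finset.piecewise_eq_of_mem, Nat.lt_one_iff, forall_eq, symbol_zero,
        forall_const]
      rfl
    · simp [corner, hj]
  · rw [Subsingleton.elim (α := Fin 1) t 0]
    exact h

theorem MACLaw.prefixEntropy_corner {𝒲 : Type*} [Fintype 𝒲] (W : Letter K 𝒬 𝒴 → 𝒲) (n : ℕ)
    (J : Finset (Fin K)) :
    p.prefixEntropy W n (corner (2 ^ n) J) = 2 ^ n * p.letterEntropy W J := by
  induction n with
  | zero => rw [pow_zero, pow_zero, one_mul, prefixEntropy_zero]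
  | succ n ih =>
    have e : corner (2 ^ (n + 1)) J = fun j => 2 * corner (2 ^ n) J j := by
      funext j
      by_cases hj : j ∈ J
      · simp [corner, hj, pow_succ']
      · simp [corner, hj]
    rw [e, prefixEntropy_double, ih, pow_succ']
    ring

/-- The marginal law of the time-sharing variable and the inputs of the users in `J`. -/
theorem MACLaw.prob_maskedInput (J : Finset (Fin K)) (ω₀ : Letter K 𝒬 𝒴) :
    prob p.letterLaw (fun ω => (maskedInput J ω, letterQ ω)) (maskedInput J ω₀, letterQ ω₀) =
      (p.timeSharing ω₀.1).toReal * ∏ j ∈ J, (p.input j ω₀.1 (ω₀.2.1 j)).toReal := by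
  classical
  have h1 : ∀ (q : 𝒬) (x : Fin K → ZMod 2) (y : 𝒴),
      (if (maskedInput J (q, x, y), letterQ (q, x, y)) = (maskedInput J ω₀, letterQ ω₀)
        then p.letterLaw (q, x, y) else 0) =
      (if q = ω₀.1 then (p.timeSharing q).toReal else 0) *
        (∏ j, if j ∈ J → x j = ω₀.2.1 j then (p.input j q (x j)).toReal else 0) *
        (p.channel x y).toReal := by
    intro q x y
    rw [Finset.prod_ite_zero]
    simp only [Prod.mk.injEq, maskedInput_eq_iff, letterQ, letterLaw, Finset.mem_univ,
      forall_const]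
    by_cases h1 : q = ω₀.1 <;> by_cases h2 : ∀ j ∈ J, x j = ω₀.2.1 j <;> simp [h1, h2]
  have h2 : ∀ q, ∑ x : Fin K → ZMod 2,
      (∏ j, if j ∈ J → x j = ω₀.2.1 j then (p.input j q (x j)).toReal else 0) =
      ∏ j ∈ J, (p.input j q (ω₀.2.1 j)).toReal := by
    intro q
    rw [← Fintype.prod_sum fun j (x : ZMod 2) =>
      if j ∈ J → x = ω₀.2.1 j then (p.input j q x).toReal else 0, ← Finset.prod_subset
        (Finset.subset_univ J)]
    · refine Finset.prod_congr rfl fun j hj => ?_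
      simp [hj]
    · intro j _ hj
      simp only [hj, false_imp_iff, if_true]
      exact sum_pmf_toReal _
  unfold prob
  rw [Finset.sum_filter]
  have h3 : ∀ q, ∑ x : Fin K → ZMod 2, ∑ y : 𝒴,
      (if q = ω₀.1 then (p.timeSharing q).toReal else 0) *
        (∏ j, if j ∈ J → x j = ω₀.2.1 j then (p.input j q (x j)).toReal else 0) *
        (p.channel x y).toReal =
      if q = ω₀.1 then (p.timeSharing q).toReal *
        ∏ j ∈ J, (p.input j q (ω₀.2.1 j)).toReal else 0 := by
    intro q
    simp only [← Finset.mul_sum, sum_pmf_toReal, mul_one, h2]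
    rw [ite_mul, zero_mul]
  rw [Fintype.sum_prod_type, ← Fintype.sum_ite_eq' ω₀.1 fun q =>
    (p.timeSharing q).toReal * ∏ j ∈ J, (p.input j q (ω₀.2.1 j)).toReal]
  refine Finset.sum_congr rfl fun q _ => ?_
  rw [← h3, Fintype.sum_prod_type]
  refine Finset.sum_congr rfl fun x _ => Finset.sum_congr rfl fun y _ => ?_
  rw [← h1]
  congr

/-- The inputs of disjoint sets of users are conditionally independent given the time-sharing
variable. -/
theorem MACLaw.letterEntropy_compl (J : Finset (Fin K)) :
    p.letterEntropy letterQ J + p.letterEntropy letterQ Jᶜ =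
      p.letterEntropy letterQ univ + p.letterEntropy letterQ ∅ := by
  simp only [letterEntropy, entropy_eq_expectation, p.prob_maskedInput]
  rw [← Finset.sum_add_distrib, ← Finset.sum_add_distrib]
  refine Finset.sum_congr rfl fun ω _ => ?_
  by_cases hω : p.letterLaw ω = 0
  · simp [hω]
  unfold letterLaw at hω
  have hq : (p.timeSharing ω.1).toReal ≠ 0 := left_ne_zero_of_mul (left_ne_zero_of_mul hω)
  have hx := Finset.prod_ne_zero_iff.mp (right_ne_zero_of_mul (left_ne_zero_of_mul hω))
  have hJ : ∀ J : Finset (Fin K), ∏ j ∈ J, (p.input j ω.1 (ω.2.1 j)).toReal ≠ 0 := fun J =>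
    Finset.prod_ne_zero_iff.mpr fun j _ => hx j (Finset.mem_univ j)
  rw [Real.logb_mul hq (hJ _), Real.logb_mul hq (hJ _), Real.logb_mul hq (hJ _),
    Real.logb_mul hq (hJ _), ← Finset.prod_mul_prod_compl J, Real.logb_mul (hJ _) (hJ _),
    Finset.prod_empty, Real.logb_one]
  ring

/-- The bounds on the rates in terms of the entropies `H(X_J, Q)` and `H(X_J, Q, Y)`. -/
theorem MACLaw.rateBound_eq (J : Finset (Fin K)) :
    p.rateBound J = (p.letterEntropy letterQ J - p.letterEntropy letterQ ∅) -
      (p.letterEntropy letterQY univ - p.letterEntropy letterQY Jᶜ) := by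
  rw [rateBound, condMutualInfo, condEntropy, condEntropy]
  congr 1
  · congr 1
    · refine entropy_congr _ fun ω ω' => ?_
      simp only [Prod.mk.injEq, maskedInput_eq_iff, restrict_eq_iff, letterQ]
    · refine entropy_congr _ fun ω ω' => ?_
      simp [Prod.mk.injEq, maskedInput_eq_iff, letterQ]
  · congr 1
    · refine entropy_congr _ fun ω ω' => ?_
      simp only [Prod.mk.injEq, maskedInput_eq_iff, restrict_eq_iff, letterQY, Finset.mem_compl,
        Finset.mem_univ, forall_const]
      constructor
      · rintro ⟨h1, ⟨h2, h3⟩, h4⟩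
        exact ⟨fun j => if h : j ∈ J then h1 j h else h3 j h, h4, h2⟩
      · rintro ⟨h1, h2, h3⟩
        exact ⟨fun j _ => h1 j, ⟨h3, fun j _ => h1 j⟩, h2⟩
    · refine entropy_congr _ fun ω ω' => ?_
      simp only [Prod.mk.injEq, maskedInput_eq_iff, restrict_eq_iff, letterQY]
      tauto

theorem MACLaw.sumRate_eq :
    condMutualInfo p.letterLaw (fun ω => ω.2.1) (fun ω => ω.2.2) (fun ω => ω.1) =
      (p.letterEntropy letterQ univ - p.letterEntropy letterQ ∅) -
      (p.letterEntropy letterQY univ - p.letterEntropy letterQY ∅) := by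
  rw [condMutualInfo, condEntropy, condEntropy]
  have hx : ∀ ω ω' : Letter K 𝒬 𝒴, ω.2.1 = ω'.2.1 ↔ ∀ j, ω.2.1 j = ω'.2.1 j := fun _ _ =>
    funext_iff
  congr 1 <;> congr 1 <;> refine entropy_congr _ fun ω ω' => ?_ <;>
    simp [maskedInput_eq_iff, letterQ, letterQY, hx, and_comm]

/-- On the dominant face, the upper bounds on the rates of the complementary sets of users turn
into the lower bounds `R(J) ≥ I(X_J; Y | Q)`. -/
theorem MACLaw.le_sum_of_mem_dominantFace {R : Fin K → ℝ} (hR : R ∈ p.dominantFace)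
    (J : Finset (Fin K)) :
    (p.letterEntropy letterQ J - p.letterEntropy letterQY J) -
      (p.letterEntropy letterQ ∅ - p.letterEntropy letterQY ∅) ≤ ∑ j ∈ J, R j := by
  obtain ⟨⟨-, hreg⟩, hsum⟩ := hR
  have h1 := hreg Jᶜ
  rw [p.rateBound_eq, compl_compl] at h1
  rw [p.sumRate_eq, ← Finset.sum_add_sum_compl J] at hsum
  linarith [p.letterEntropy_compl J]

theorem MACLaw.prefixInformation_corner (n : ℕ) (J : Finset (Fin K)) :
    p.prefixInformation n (corner (2 ^ n) J) =
      2 ^ n * (p.letterEntropy letterQ J - p.letterEntropy letterQY J) := by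
  rw [prefixInformation, prefixEntropy_corner, prefixEntropy_corner]
  ring

theorem MACLaw.abs_gain_prefixInformation_le (n : ℕ) (a : Fin K → ℕ) (j : Fin K) :
    |p.prefixInformation n (step a j) - p.prefixInformation n a| ≤ 1 := by
  have h := p.gain_prefixInformation (n := n) a j
  rw [gain] at h
  rw [h, nodeInformation, abs_le]
  have H1 := p.isPolarizing (letterQ (𝒬 := 𝒬) (𝒴 := 𝒴))
  have H2 := p.isPolarizing (letterQY (𝒬 := 𝒬) (𝒴 := 𝒴))
  constructor <;> linarith [H1.h_nonneg (n, a, j), H1.h_le_one (n, a, j), H2.h_nonneg (n, a, j),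
    H2.h_le_one (n, a, j)]

/-- Every point of the dominant face is approximated by the rates of a lattice path. -/
theorem MACLaw.exists_walk_of_mem_dominantFace {R : Fin K → ℝ} (hR : R ∈ p.dominantFace) (n : ℕ) :
    ∃ w : List (Fin K), (∀ j, w.count j = 2 ^ n) ∧ ∀ j,
      |walkSum (fun b i => p.nodeInformation (n, b, i)) 0 w j - 2 ^ n * R j| ≤ 3 ^ K := by
  have hpos : (0 : ℝ) < 2 ^ n := by positivity
  have e0 : (0 : Fin K → ℕ) = corner (2 ^ n) ∅ := by simp [corner]
  have e1 : (fun _ : Fin K => 2 ^ n) = corner (2 ^ n) univ := by simp [corner]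
  obtain ⟨w, hw, hwR⟩ := exists_walk (F := p.prefixInformation n)
    (p.abs_gain_prefixInformation_le n) K univ (by simp) 0 (fun _ => 2 ^ n) (fun j => 2 ^ n * R j)
    0 le_rfl (fun _ => Nat.zero_le _) (by simp)
    (by
      intro J _
      change p.prefixInformation n (corner (2 ^ n) J) - _ - 0 ≤ _
      rw [e0, p.prefixInformation_corner, p.prefixInformation_corner, ← Finset.mul_sum]
      have := mul_le_mul_of_nonneg_left (p.le_sum_of_mem_dominantFace hR J) hpos.le
      linarith)
    (by
      rw [e0, e1, p.prefixInformation_corner, p.prefixInformation_corner, ← Finset.mul_sum, hR.2,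
        p.sumRate_eq]
      apply le_of_eq
      ring)
  refine ⟨w, fun j => ?_, fun j => ?_⟩
  · have := count_of_walkEnd hw j
    simpa using this
  · have := hwR j (Finset.mem_univ j)
    rw [zero_add, mul_one] at this
    have e : gain (p.prefixInformation n) = fun b i => p.nodeInformation (n, b, i) := by
      funext b i
      exact p.gain_prefixInformation b i
    rwa [e] at this

/-- Polarization of the information of the symbols below a node: the symbols with large entropy
given the preceding ones and those with small entropy given also the channel output both have the
right frequency, and a symbol of both kinds has information close to `1`. -/
theorem MACLaw.exists_mean_good_ge {β : ℝ} (hβ : β < 1 / 2) {η : ℝ} (hη : 0 < η) (n₀ : ℕ) :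
    ∃ l : ℕ, ∀ x : Node K, p.nodeInformation x - 2 * η ≤
      (branchMean Node.minus Node.plus)^[l] (fun y =>
        if 1 - (2 : ℝ) ^ (-(((2 : ℝ) ^ (n₀ + l)) ^ β)) < p.nodeInformation y then 1 else 0) x := by
  obtain ⟨l, hl⟩ := exists_mean_le hβ hη n₀
  refine ⟨l, fun x => ?_⟩
  have H1 := p.isPolarizing (letterQ (𝒬 := 𝒬) (𝒴 := 𝒴))
  have H2 := p.isPolarizing (letterQY (𝒬 := 𝒬) (𝒴 := 𝒴))
  have b1 := hl (Node K) _ _ _ _ _ H1.swap x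
  have b2 := hl (Node K) _ _ _ _ _ H2 x
  rw [branchMean_comm] at b1
  set τ := (2 : ℝ) ^ (-(((2 : ℝ) ^ (n₀ + l)) ^ β)) with hτ
  have hpt : ∀ y : Node K, 1 ≤ (if 1 - τ < p.nodeInformation y then (1 : ℝ) else 0) +
      ((if τ / 2 ≤ 3 * p.nodeBias letterQ y then (1 : ℝ) else 0) +
        if τ / 2 ≤ 3 * p.nodeBhattacharyya letterQY y then (1 : ℝ) else 0) := by
    intro y
    have g1 := H1.one_sub_h_le y
    have g2 := H2.h_le y
    rw [nodeInformation]
    split_ifs <;> first | (exfalso; linarith) | norm_num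
  have key := branchMean_iterate_mono Node.minus Node.plus hpt l x
  rw [branchMean_iterate_const, branchMean_iterate_add, branchMean_iterate_add] at key
  rw [nodeInformation]
  linarith

theorem MACLaw.mean_nodeInformation (l : ℕ) (x : Node K) :
    (branchMean Node.minus Node.plus)^[l] p.nodeInformation x = p.nodeInformation x := by
  refine branchMean_iterate_of_harmonic _ _ (fun y => ?_) l x
  have H1 := (p.isPolarizing (letterQ (𝒬 := 𝒬) (𝒴 := 𝒴))).harmonic y
  have H2 := (p.isPolarizing (letterQY (𝒬 := 𝒬) (𝒴 := 𝒴))).harmonic y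
  simp only [nodeInformation]
  linarith

end Face

end

end PolarMAC

theorem mainTheorem2 {K : ℕ} {𝒬 𝒴 : Type*} [Fintype 𝒬] [Fintype 𝒴]
    (p : PolarMAC.MACLaw K 𝒬 𝒴) (ε : ℝ) (hε : 0 < ε) (β : ℝ) (hβ : β < 1 / 2)
    (I : Fin K → ℝ) (hI : I ∈ p.dominantFace) :
    ∃ (n : ℕ) (σ : PolarMAC.MonotonePermutation K (2 ^ n)), ∀ j : Fin K,
      |p.rate σ j - I j| ≤ ε ∧
      ((p.goodIndices σ β j).card : ℝ) / 2 ^ n > p.rate σ j - ε := by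
  open PolarMAC in
  obtain ⟨n₀, hn₀⟩ := pow_unbounded_of_one_lt (3 ^ K / ε) (one_lt_two : (1 : ℝ) < 2)
  obtain ⟨w, hw, hwR⟩ := p.exists_walk_of_mem_dominantFace hI n₀
  obtain ⟨l, hl⟩ := p.exists_mean_good_ge hβ (η := ε / 4) (by linarith) n₀
  have hw' : ∀ j, (doubleSteps^[l] w).count j = 2 ^ (n₀ + l) := fun j => by
    rw [count_doubleSteps_iterate, hw, pow_add, mul_comm]
  have hpos : (0 : ℝ) < 2 ^ n₀ := by positivity
  have hposl : (0 : ℝ) < 2 ^ l := by positivity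
  refine ⟨n₀ + l, MonotonePermutation.ofList (doubleSteps^[l] w) hw', fun j => ?_⟩
  set r := walkSum (fun b i => p.nodeInformation (n₀, b, i)) 0 w j with hr
  have hrate : p.rate (MonotonePermutation.ofList (doubleSteps^[l] w) hw') j = r / 2 ^ n₀ := by
    rw [p.rate_ofList, walkSum_doubleSteps_iterate]
    simp only [p.mean_nodeInformation]
    rw [← hr, pow_add]
    field_simp
  constructor
  · have e : r / 2 ^ n₀ - I j = (r - 2 ^ n₀ * I j) / 2 ^ n₀ := by field_simp
    rw [hrate, e, abs_div, abs_of_pos hpos, div_le_iff₀ hpos]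
    rw [div_lt_iff₀ hε] at hn₀
    linarith [hwR j]
  · rw [hrate, p.card_goodIndices_ofList, gt_iff_lt]
    have h1 := walkSum_doubleSteps_iterate (fun y : Node K =>
      if 1 - (2 : ℝ) ^ (-(((2 : ℝ) ^ (n₀ + l)) ^ β)) < p.nodeInformation y then 1 else 0) n₀ l w j
    have h2 := walkSum_mono (fun b i => hl (n₀, b, i)) 0 w j
    rw [walkSum_sub_const, ← hr, hw] at h2
    have h3 : r / 2 ^ n₀ - ε < (2 ^ l * (r - (2 ^ n₀ : ℕ) * (2 * (ε / 4)))) / 2 ^ (n₀ + l) := by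
      have : (2 ^ l * (r - (2 ^ n₀ : ℕ) * (2 * (ε / 4)))) / 2 ^ (n₀ + l) =
          r / 2 ^ n₀ - ε / 2 := by
        rw [pow_add]
        push_cast
        field_simp
        ring
      rw [this]
      linarith
    refine h3.trans_le (div_le_div_of_nonneg_right ?_ (by positivity))
    refine (mul_le_mul_of_nonneg_left h2 hposl.le).trans ?_
    rw [← h1]
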